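/- Let $\mathcal D\subset\mathbb R^2$ be an open, bounded, simply connected region whose boundary $\partial\mathcal D$ is a simple closed, piecewise $C^2$ curve with finitely many corners (each with external angle in $(-\pi,\pi)$, so that there are no cusps), and assume that the set of points of $\partial\mathcal D$ at which the curvature is defined and vanishes is a finite union of intervals (single points being allowed as intervals). Let $\boldsymbol\chi:\overline{\mathcal D}\to\mathbb R^3$ be a $C^2$ isometric immersion, that is, a map of class $C^2$ on $\overline{\mathcal D}$ whose gradient preserves the lengths of vectors. A \emph{ruling} of $\boldsymbol\chi$ is a straight line segment of positive length with both endpoints on $\partial\mathcal D$ whose relative interior is contained in $\{x\in\mathcal D:\nabla\nabla\boldsymbol\chi(x)\neq 0\}$ and which $\boldsymbol\chi$ maps to a straight asymptotic curve of the image surface. Two different rulings \emph{meet} at a point $x\in\partial\mathcal D$ if $x$ is an endpoint of both. Then: (i) if two rulings meet at a point of $\partial\mathcal D$, they are collinear (contained in one straight line); (ii) the set of all points of $\partial\mathcal D$ at which two different rulings meet is finite. -/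

import Mathlib

open Set

namespace DevelopableRulings

/-- The plane that contains the reference region, with its Euclidean norm. -/
abbrev Plane : Type := EuclideanSpace ℝ (Fin 2)

/-- The three-dimensional Euclidean space that contains the deformed surface. -/
abbrev Space : Type := EuclideanSpace ℝ (Fin 3)

/-- `c` is the `ℓ`-periodic extension of an arclength parametrization of a simple closed plane
curve of length `ℓ` that is piecewise `C²`, has finitely many corners (and no cusps), and whose
curvature, where it is defined, vanishes exactly on a finite union of intervals. -/
structure IsPiecewiseC2Loop (c : ℝ → Plane) (ℓ : ℝ) : Prop where
  length_pos : 0 < ℓ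
  continuous : Continuous c
  periodic : Function.Periodic c ℓ
  /-- The closed curve is simple. -/
  injOn : InjOn c (Ico 0 ℓ)
  /-- All but finitely many points of the curve are points of class `C²`. -/
  finite_breaks : {s ∈ Ico 0 ℓ | ¬ ContDiffAt ℝ 2 c s}.Finite
  /-- The curve is `C²` up to the endpoint on either side of each of its points; in particular the
  one-sided tangents and curvatures exist at the corners. -/
  oneSided : ∀ s : ℝ, ∃ ε > 0,
    ContDiffOn ℝ 2 c (Icc (s - ε) s) ∧ ContDiffOn ℝ 2 c (Icc s (s + ε))
  /-- Both one-sided tangents are unit vectors. -/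
  norm_tangent_left : ∀ s : ℝ, ‖derivWithin c (Iic s) s‖ = 1
  norm_tangent_right : ∀ s : ℝ, ‖derivWithin c (Ici s) s‖ = 1
  /-- No cusps: the tangent never reverses, so that the external angle, which the incoming tangent
  has to turn through to become the outgoing one, is a well-defined element of `(-π, π)`. -/
  no_cusp : ∀ s : ℝ, derivWithin c (Ici s) s ≠ - derivWithin c (Iic s) s
  /-- The curvature vanishes on a finite number of intervals only (an interval may be a single
  point). As the speed is `1`, the curvature is `± ‖c''‖`. -/
  curvature_zeros : ∃ J : Set (Set ℝ), J.Finite ∧ (∀ I ∈ J, I.OrdConnected) ∧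
    {s ∈ Ico 0 ℓ | ContDiffAt ℝ 2 c s ∧ iteratedDeriv 2 c s = 0} = ⋃₀ J

/-- A reference region: an open, bounded, simply connected plane region whose boundary is a simple
closed piecewise `C²` curve with finitely many corners, and with curvature that vanishes on finitely
many intervals only. -/
structure IsReferenceRegion (D : Set Plane) : Prop where
  isOpen : IsOpen D
  isBounded : Bornology.IsBounded D
  isSimplyConnected : IsSimplyConnected D
  boundary : ∃ (c : ℝ → Plane) (ℓ : ℝ), IsPiecewiseC2Loop c ℓ ∧ range c = frontier D

/-- `χ` is a `C²` isometric immersion of the closure of `D` into space: it is of class `C²` on the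
closure, and its gradient preserves the lengths of vectors. The latter is required on `D`; it passes
to the closure by continuity. For a reference region the immersion is then automatically locally
injective on the closure. -/
structure IsC2IsometricImmersion (D : Set Plane) (χ : Plane → Space) : Prop where
  contDiffOn : ContDiffOn ℝ 2 χ (closure D)
  isometric : ∀ x ∈ D, ∀ v : Plane, ‖fderiv ℝ χ x v‖ = ‖v‖

/-- The segment with endpoints `p` and `q` is a (reference) ruling of `χ`: it has positive length,
its endpoints lie on the boundary of `D`, its other points lie in the part of `D` where the second
derivative of `χ` does not vanish, and `χ` maps it to a straight asymptotic curve.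

For an isometric immersion the second derivative takes values normal to the surface, so the image
curve is asymptotic (has zero normal curvature) exactly if the second derivative vanishes on the
pair `(q - p, q - p)`. -/
structure IsRuling (D : Set Plane) (χ : Plane → Space) (p q : Plane) : Prop where
  ne : p ≠ q
  left_mem : p ∈ frontier D
  right_mem : q ∈ frontier D
  openSegment_subset : openSegment ℝ p q ⊆ D
  curved : ∀ x ∈ openSegment ℝ p q, iteratedFDeriv ℝ 2 χ x ≠ 0
  straight : χ '' segment ℝ p q = segment ℝ (χ p) (χ q)
  asymptotic : ∀ x ∈ openSegment ℝ p q, iteratedFDeriv ℝ 2 χ x ![q - p, q - p] = 0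

/-- The rulings from `x` to `p` and from `x` to `q` are different; they meet at their shared
endpoint `x`. -/
def RulingsMeet (D : Set Plane) (χ : Plane → Space) (x p q : Plane) : Prop :=
  IsRuling D χ x p ∧ IsRuling D χ x q ∧ p ≠ q

end DevelopableRulings

namespace DevelopableRulings

open Filter Topology Metric

/-! Write `T` for the second derivative of `χ`. Differentiating the isometry condition shows that
`T` is normal to the surface. It is also degenerate (`exists_fderiv_fderiv_eq_zero`). Only two
derivatives are available, so this is not a computation with third derivatives: if `T` were
nondegenerate, components of the gradient would be local coordinates in which the normal direction
is constant, and this forces `T` to have a zero value that was chosen nonzero. Hence an asymptotic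
direction lies in the kernel of `T`, the gradient is constant along a ruling, and two rulings in
different directions cannot cross in `D`, because `T` would vanish at the crossing.

For (i), the reciprocal of the second derivative across a ruling is affine along it
(`exists_inv_eq_affine`). It stays bounded, so the second derivative itself cannot tend to zero at
an endpoint (`IsRuling.limit_ne_zero`). Since `T` extends continuously to the boundary, a second
ruling that left the same endpoint in a transverse direction `e` would give `T(e, e)` the limit zero
there. So rulings that meet are parallel, and they leave the common endpoint in opposite directions
because no endpoint of one is interior to the other.

For (ii), it suffices by compactness to treat a neighbourhood of one parameter `s₀`. There the
region is the part of the plane above a graph (`IsGraphChart`), and each of the two arcs beside `s₀`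
can be chosen with curvature identically zero or nowhere zero. At a meeting point on such an arc the
common line runs inside `D` on both sides, so it is tangent to the boundary and the boundary lies
strictly below it nearby. This leaves only arcs of strictly decreasing slope. If meetings occurred
at two points of such an arc, the two tangents would cross over the arc, rulings along both would
reach the crossing, and it would lie in `D`: impossible. Each arc thus carries at most one meeting
(`IsGraphChart.meeting_unique`). -/

/-! ### Calculus in local coordinates. -/

theorem hasDerivAt_mk_left {G : ℝ × ℝ → ℝ} {A : ℝ × ℝ →L[ℝ] ℝ} {a b : ℝ}
    (h : HasFDerivAt G A (a, b)) : HasDerivAt (fun s => G (s, b)) (A (1, 0)) a :=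
  h.comp_hasDerivAt a ((hasDerivAt_id a).prodMk (hasDerivAt_const a b))

theorem hasDerivAt_mk_right {G : ℝ × ℝ → ℝ} {A : ℝ × ℝ →L[ℝ] ℝ} {a b : ℝ}
    (h : HasFDerivAt G A (a, b)) : HasDerivAt (fun t => G (a, t)) (A (0, 1)) b :=
  h.comp_hasDerivAt b ((hasDerivAt_const b a).prodMk (hasDerivAt_id b))

/-- A function on a square whose differential is a multiple of `dy` depends on `y` only, and so does
the factor. -/
theorem eq_of_hasFDerivAt_smul_snd {G R : ℝ × ℝ → ℝ} {x₀ y₀ ε : ℝ}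
    (hG : ∀ a ∈ ball x₀ ε, ∀ b ∈ ball y₀ ε,
      HasFDerivAt G (R (a, b) • ContinuousLinearMap.snd ℝ ℝ ℝ) (a, b))
    {a a' b : ℝ} (ha : a ∈ ball x₀ ε) (ha' : a' ∈ ball x₀ ε) (hb : b ∈ ball y₀ ε) :
    R (a, b) = R (a', b) := by
  -- `R` need not be differentiable, so mixed partials are not available: first `G` loses its
  -- dependence on the first variable, then the partials in the second variable are compared.
  have key : ∀ t ∈ ball y₀ ε, G (a, t) = G (a', t) := by
    intro t ht
    have hd : ∀ s ∈ ball x₀ ε, HasDerivAt (fun s => G (s, t)) 0 s := fun s hs => by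
      simpa using hasDerivAt_mk_left (hG s hs t ht)
    exact isOpen_ball.is_const_of_deriv_eq_zero (convex_ball x₀ ε).isPreconnected
      (fun s hs => (hd s hs).differentiableAt.differentiableWithinAt)
      (fun s hs => (hd s hs).deriv) ha ha'
  have h1 : HasDerivAt (fun t => G (a, t)) (R (a, b)) b := by
    simpa using hasDerivAt_mk_right (hG a ha b hb)
  have h2 : HasDerivAt (fun t => G (a', t)) (R (a', b)) b := by
    simpa using hasDerivAt_mk_right (hG a' ha' b hb)
  refine h1.unique (h2.congr_of_eventuallyEq ?_)
  filter_upwards [isOpen_ball.mem_nhds hb] with t ht using key t ht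

theorem eq_of_hasFDerivAt_smul_fst {G R : ℝ × ℝ → ℝ} {x₀ y₀ ε : ℝ}
    (hG : ∀ a ∈ ball x₀ ε, ∀ b ∈ ball y₀ ε,
      HasFDerivAt G (R (a, b) • ContinuousLinearMap.fst ℝ ℝ ℝ) (a, b))
    {a b b' : ℝ} (ha : a ∈ ball x₀ ε) (hb : b ∈ ball y₀ ε) (hb' : b' ∈ ball y₀ ε) :
    R (a, b) = R (a, b') := by
  refine eq_of_hasFDerivAt_smul_snd (G := G ∘ Prod.swap) (R := R ∘ Prod.swap)
    (x₀ := y₀) (y₀ := x₀) (ε := ε) (fun s hs t ht => ?_) hb hb' ha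
  have := (hG t ht s hs).comp (s, t)
    (ContinuousLinearEquiv.prodComm ℝ ℝ ℝ).toContinuousLinearMap.hasFDerivAt
  refine this.congr_fderiv ?_
  ext <;> simp

/-- Inverse function theorem between spaces of equal finite dimension. -/
theorem exists_local_inverse {E F : Type*} [NormedAddCommGroup E] [NormedSpace ℝ E]
    [FiniteDimensional ℝ E] [NormedAddCommGroup F] [NormedSpace ℝ F] [FiniteDimensional ℝ F]
    {Φ : E → F} {A : E →L[ℝ] F} {z : E} (hΦ : ContDiffAt ℝ 1 Φ z) (hA : HasFDerivAt Φ A z)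
    (hinj : Function.Injective A) (hdim : Module.finrank ℝ E = Module.finrank ℝ F) :
    ∃ Ψ : F → E, Ψ (Φ z) = z ∧ ContDiffAt ℝ 1 Ψ (Φ z) ∧ (∀ᶠ y in 𝓝 (Φ z), Φ (Ψ y) = y) ∧
      ∀ᶠ x in 𝓝 z, Ψ (Φ x) = x := by
  have : CompleteSpace E := FiniteDimensional.complete ℝ E
  let e : E ≃L[ℝ] F := (LinearMap.linearEquivOfInjective (A : E →ₗ[ℝ] F) hinj
    hdim).toContinuousLinearEquiv
  have he : (e : E →L[ℝ] F) = A := by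
    ext x; rfl
  have hA' : HasFDerivAt Φ (e : E →L[ℝ] F) z := he ▸ hA
  have hs : HasStrictFDerivAt Φ (e : E →L[ℝ] F) z := hΦ.hasStrictFDerivAt' hA' one_ne_zero
  exact ⟨hΦ.localInverse hA' one_ne_zero, hΦ.localInverse_apply_image hA' one_ne_zero,
    hΦ.to_localInverse hA' one_ne_zero, hs.eventually_right_inverse, hs.eventually_left_inverse⟩

/-- If `p, q` are local coordinates and `dP = r dp`, `dQ = r dq`, then `r` is locally constant. -/
theorem eventually_eq_of_hasFDerivAt_smul {E : Type*} [NormedAddCommGroup E] [NormedSpace ℝ E]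
    [FiniteDimensional ℝ E] (hdim : Module.finrank ℝ E = 2) {p q P Q r : E → ℝ} {z : E}
    {p' q' : E → E →L[ℝ] ℝ} (hpc : ContDiffAt ℝ 1 p z) (hqc : ContDiffAt ℝ 1 q z)
    (hp : ∀ᶠ x in 𝓝 z, HasFDerivAt p (p' x) x) (hq : ∀ᶠ x in 𝓝 z, HasFDerivAt q (q' x) x)
    (hinj : ∀ v, p' z v = 0 → q' z v = 0 → v = 0)
    (hP : ∀ᶠ x in 𝓝 z, HasFDerivAt P (r x • p' x) x)
    (hQ : ∀ᶠ x in 𝓝 z, HasFDerivAt Q (r x • q' x) x) :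
    ∀ᶠ x in 𝓝 z, r x = r z := by
  obtain ⟨Ψ, hΨz, hΨc, hr, hl⟩ := exists_local_inverse (Φ := fun x => (p x, q x))
    (hpc.prodMk hqc) (hp.self_of_nhds.prodMk hq.self_of_nhds)
    (by
      rw [injective_iff_map_eq_zero]
      intro v hv
      simp only [ContinuousLinearMap.prod_apply, Prod.mk_eq_zero] at hv
      exact hinj v hv.1 hv.2)
    (by simp [hdim])
  have hcont : Tendsto Ψ (𝓝 (p z, q z)) (𝓝 z) := by
    have := hΨc.continuousAt.tendsto
    rwa [hΨz] at this
  have hd : ∀ᶠ y in 𝓝 (p z, q z), DifferentiableAt ℝ Ψ y :=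
    (hΨc.eventually (by simp)).mono fun y hy => hy.differentiableAt one_ne_zero
  have hall := (((hr.eventually_nhds.and hd).and (hcont.eventually hp)).and
    (hcont.eventually hq)).and ((hcont.eventually hP).and (hcont.eventually hQ))
  obtain ⟨ε, hε, hball⟩ := Metric.eventually_nhds_iff_ball.1 hall
  rw [← ball_prod_same] at hball
  have hcoord : ∀ a ∈ ball (p z) ε, ∀ b ∈ ball (q z) ε,
      HasFDerivAt (P ∘ Ψ) (r (Ψ (a, b)) • ContinuousLinearMap.fst ℝ ℝ ℝ) (a, b) ∧
      HasFDerivAt (Q ∘ Ψ) (r (Ψ (a, b)) • ContinuousLinearMap.snd ℝ ℝ ℝ) (a, b) := by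
    intro a ha b hb
    obtain ⟨⟨⟨⟨hr, hd⟩, hp⟩, hq⟩, hP, hQ⟩ := hball (a, b) ⟨ha, hb⟩
    have h1 : (p' (Ψ (a, b))).comp (fderiv ℝ Ψ (a, b)) = ContinuousLinearMap.fst ℝ ℝ ℝ :=
      (hp.comp (a, b) hd.hasFDerivAt).unique (hasFDerivAt_fst.congr_of_eventuallyEq
        (hr.mono fun y hy => congrArg Prod.fst hy))
    have h2 : (q' (Ψ (a, b))).comp (fderiv ℝ Ψ (a, b)) = ContinuousLinearMap.snd ℝ ℝ ℝ :=
      (hq.comp (a, b) hd.hasFDerivAt).unique (hasFDerivAt_snd.congr_of_eventuallyEq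
        (hr.mono fun y hy => congrArg Prod.snd hy))
    refine ⟨?_, ?_⟩
    · rw [← h1]; exact hP.comp (a, b) hd.hasFDerivAt
    · rw [← h2]; exact hQ.comp (a, b) hd.hasFDerivAt
  -- `P ∘ Ψ` makes `r ∘ Ψ` a function of the first coordinate alone, and `Q ∘ Ψ` makes it a function
  -- of the second alone.
  have hconst : ∀ a ∈ ball (p z) ε, ∀ b ∈ ball (q z) ε, r (Ψ (a, b)) = r z := by
    intro a ha b hb
    have e1 := eq_of_hasFDerivAt_smul_fst (G := P ∘ Ψ) (R := r ∘ Ψ)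
      (fun a ha b hb => (hcoord a ha b hb).1) ha hb (mem_ball_self hε)
    have e2 := eq_of_hasFDerivAt_smul_snd (G := Q ∘ Ψ) (R := r ∘ Ψ)
      (fun a ha b hb => (hcoord a ha b hb).2) ha (mem_ball_self hε) (mem_ball_self hε)
    simp only [Function.comp_apply] at e1 e2
    rw [e1, e2, hΨz]
  have hΦ : Tendsto (fun x => (p x, q x)) (𝓝 z) (𝓝 (p z, q z)) :=
    (hpc.continuousAt.prodMk hqc.continuousAt).tendsto
  have hb : ball (p z) ε ×ˢ ball (q z) ε ∈ 𝓝 (p z, q z) :=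
    prod_mem_nhds (ball_mem_nhds _ hε) (ball_mem_nhds _ hε)
  filter_upwards [hΦ hb, hl] with x hx hx'
  rw [← hconst _ hx.1 _ hx.2, hx']

/-- The reciprocal of the second derivative across a ruling of a developable graph is an affine
function along the ruling. Here `(a, b)` is the gradient of the height function and `a₁, a₂, b₂`
are the entries of its Hessian. -/
theorem exists_inv_eq_affine {a b a₁ a₂ b₂ : ℝ × ℝ → ℝ} {s₀ t₀ : ℝ}
    (hbc : ContDiffAt ℝ 1 b (s₀, t₀))
    (ha : ∀ᶠ z in 𝓝 (s₀, t₀), HasFDerivAt a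
      (a₁ z • ContinuousLinearMap.fst ℝ ℝ ℝ + a₂ z • ContinuousLinearMap.snd ℝ ℝ ℝ) z)
    (hb : ∀ᶠ z in 𝓝 (s₀, t₀), HasFDerivAt b
      (a₂ z • ContinuousLinearMap.fst ℝ ℝ ℝ + b₂ z • ContinuousLinearMap.snd ℝ ℝ ℝ) z)
    (hdet : ∀ᶠ z in 𝓝 (s₀, t₀), a₁ z * b₂ z = a₂ z * a₂ z) (hne : b₂ (s₀, t₀) ≠ 0)
    (hconst : ∀ᶠ s in 𝓝 s₀, b (s, t₀) = b (s₀, t₀)) :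
    ∃ m : ℝ, ∀ᶠ s in 𝓝 s₀, (b₂ (s, t₀))⁻¹ = (b₂ (s₀, t₀))⁻¹ + m * (s - s₀) := by
  set w₀ := b (s₀, t₀) with hw₀
  obtain ⟨Ψ, hΨz, hΨc, hr, hl⟩ := exists_local_inverse (Φ := fun z : ℝ × ℝ => (z.1, b z))
    (contDiffAt_fst.prodMk hbc) (hasFDerivAt_fst.prodMk hb.self_of_nhds)
    (by
      rw [injective_iff_map_eq_zero]
      rintro ⟨v, w⟩ hv
      simp only [ContinuousLinearMap.prod_apply, Prod.mk_eq_zero, ContinuousLinearMap.coe_fst',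
        add_apply, smul_apply,
        ContinuousLinearMap.coe_snd', smul_eq_mul] at hv
      obtain ⟨rfl, hv⟩ := hv
      simpa [hne] using hv)
    rfl
  have hcont : Tendsto Ψ (𝓝 (s₀, w₀)) (𝓝 (s₀, t₀)) := by
    have := hΨc.continuousAt.tendsto
    rwa [hΨz] at this
  have hd : ∀ᶠ y in 𝓝 (s₀, w₀), DifferentiableAt ℝ Ψ y :=
    (hΨc.eventually (by simp)).mono fun y hy => hy.differentiableAt one_ne_zero
  have hall := ((hr.eventually_nhds.and hd).and (hcont.eventually ha)).and
    ((hcont.eventually hb).and (hcont.eventually hdet))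
  obtain ⟨ε, hε, hball⟩ := Metric.eventually_nhds_iff_ball.1 hall
  rw [← ball_prod_same] at hball
  -- In the coordinates `(s, w)` with `w = b (s, t)`, `Y` is the old coordinate `t`. Thus `Y₂` is `1
  -- / b₂`, and `ρ` is the derivative of `a` with respect to `w`. The determinant condition makes
  -- `a` a function of `w` alone, so `∂Y/∂s = -ρ` does not depend on `s`.
  set Y : ℝ × ℝ → ℝ := fun y => (Ψ y).2 with hY
  set Y₂ : ℝ × ℝ → ℝ := fun y => fderiv ℝ Y y (0, 1) with hY₂
  set ρ : ℝ × ℝ → ℝ := fun y => a₂ (Ψ y) * Y₂ y with hρ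
  have hloc : ∀ s ∈ ball s₀ ε, ∀ w ∈ ball w₀ ε,
      HasFDerivAt Y (fderiv ℝ Y (s, w)) (s, w) ∧ b₂ (Ψ (s, w)) * Y₂ (s, w) = 1 ∧
      fderiv ℝ Y (s, w) (1, 0) = - ρ (s, w) ∧
      HasFDerivAt (a ∘ Ψ) (ρ (s, w) • ContinuousLinearMap.snd ℝ ℝ ℝ) (s, w) := by
    intro s hs w hw
    obtain ⟨⟨⟨hr, hd⟩, ha⟩, hb, hdet⟩ := hball (s, w) ⟨hs, hw⟩
    have hYd : HasFDerivAt Y (fderiv ℝ Y (s, w)) (s, w) := hd.snd.hasFDerivAt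
    have h1 : HasFDerivAt (fun y => (Ψ y).1) (ContinuousLinearMap.fst ℝ ℝ ℝ) (s, w) :=
      hasFDerivAt_fst.congr_of_eventuallyEq (hr.mono fun y hy => (Prod.ext_iff.1 hy).1)
    have hΨd : HasFDerivAt Ψ ((ContinuousLinearMap.fst ℝ ℝ ℝ).prod (fderiv ℝ Y (s, w))) (s, w) :=
      h1.prodMk hYd
    have h2 := (hb.comp (s, w) hΨd).unique (hasFDerivAt_snd.congr_of_eventuallyEq
        (hr.mono fun y hy => congrArg Prod.snd hy))
    have h2s := DFunLike.congr_fun h2 (1, 0)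
    have h2w := DFunLike.congr_fun h2 (0, 1)
    simp only [ContinuousLinearMap.comp_apply, ContinuousLinearMap.prod_apply,
      add_apply, smul_apply,
      ContinuousLinearMap.coe_fst', ContinuousLinearMap.coe_snd', smul_eq_mul, mul_one, mul_zero,
      zero_add] at h2s h2w
    have h2w' : b₂ (Ψ (s, w)) * Y₂ (s, w) = 1 := h2w
    have h3 : fderiv ℝ Y (s, w) (1, 0) = - ρ (s, w) := by
      simp only [hρ]
      linear_combination (Y₂ (s, w)) * h2s - (fderiv ℝ Y (s, w) (1, 0)) * h2w'
    refine ⟨hYd, h2w', h3, (ha.comp (s, w) hΨd).congr_fderiv ?_⟩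
    have hz : a₁ (Ψ (s, w)) + a₂ (Ψ (s, w)) * (- ρ (s, w)) = 0 := by
      simp only [hρ]
      linear_combination (Y₂ (s, w)) * hdet - (a₁ (Ψ (s, w))) * h2w'
    ext
    · simpa [h3] using hz
    · simp [hρ, hY₂]
  have hρc : ∀ s ∈ ball s₀ ε, ∀ w ∈ ball w₀ ε, ρ (s, w) = ρ (s₀, w) := fun s hs w hw =>
    eq_of_hasFDerivAt_smul_snd (G := a ∘ Ψ) (R := ρ)
      (fun s hs w hw => (hloc s hs w hw).2.2.2) hs (mem_ball_self hε) hw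
  have haff : ∀ s ∈ ball s₀ ε, ∀ w ∈ ball w₀ ε,
      Y (s, w) - Y (s₀, w) = - ρ (s₀, w) * (s - s₀) := by
    intro s hs w hw
    have hd : ∀ u ∈ ball s₀ ε,
        HasDerivAt (fun u => Y (u, w) + ρ (s₀, w) * (u - s₀)) 0 u := fun u hu => by
      have h1 := hasDerivAt_mk_left (hloc u hu w hw).1
      rw [(hloc u hu w hw).2.2.1, hρc u hu w hw] at h1
      refine (h1.add (((hasDerivAt_id u).sub_const s₀).const_mul (ρ (s₀, w)))).congr_deriv ?_
      ring
    have := isOpen_ball.is_const_of_deriv_eq_zero (convex_ball s₀ ε).isPreconnected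
      (fun u hu => (hd u hu).differentiableAt.differentiableWithinAt)
      (fun u hu => (hd u hu).deriv) hs (mem_ball_self hε)
    simp only [sub_self, mul_zero, add_zero] at this
    linarith
  have hw₀b : w₀ ∈ ball w₀ ε := mem_ball_self hε
  have hs₀b : s₀ ∈ ball s₀ ε := mem_ball_self hε
  -- Differentiability of the slope `ρ (s₀, ·)` is not at hand. Eliminating it with a second
  -- abscissa leaves an identity between values of `Y`, which can be differentiated in `w`.
  set s₁ := s₀ + ε / 2 with hs₁
  have hs₁b : s₁ ∈ ball s₀ ε := by
    rw [mem_ball, Real.dist_eq, hs₁, add_sub_cancel_left, abs_of_pos (by linarith)]; linarith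
  have hY₂a : ∀ s ∈ ball s₀ ε,
      (s₁ - s₀) * (Y₂ (s, w₀) - Y₂ (s₀, w₀)) = (s - s₀) * (Y₂ (s₁, w₀) - Y₂ (s₀, w₀)) := by
    intro s hs
    have hd : ∀ u ∈ ball s₀ ε, HasDerivAt (fun w => Y (u, w)) (Y₂ (u, w₀)) w₀ :=
      fun u hu => hasDerivAt_mk_right (hloc u hu w₀ hw₀b).1
    refine (((hd s hs).sub (hd s₀ hs₀b)).const_mul (s₁ - s₀)).unique
      ((((hd s₁ hs₁b).sub (hd s₀ hs₀b)).const_mul (s - s₀)).congr_of_eventuallyEq ?_)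
    filter_upwards [isOpen_ball.mem_nhds hw₀b] with w hw
    have e1 := haff s hs w hw
    have e2 := haff s₁ hs₁b w hw
    simp only [Pi.sub_apply]
    rw [e1, e2]; ring
  refine ⟨(Y₂ (s₁, w₀) - Y₂ (s₀, w₀)) / (s₁ - s₀), ?_⟩
  have hl' : ∀ᶠ s in 𝓝 s₀, Ψ (s, b (s, t₀)) = (s, t₀) :=
    (Continuous.tendsto' (f := fun s : ℝ => (s, t₀)) (by fun_prop) s₀ (s₀, t₀) rfl).eventually hl
  have hY₂v : ∀ s ∈ ball s₀ ε, b (s, t₀) = w₀ → Ψ (s, b (s, t₀)) = (s, t₀) →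
      (b₂ (s, t₀))⁻¹ = Y₂ (s, w₀) := by
    intro s hs h1 h2
    have h3 := (hloc s hs w₀ hw₀b).2.1
    rw [h1] at h2
    rw [h2] at h3
    exact inv_eq_of_mul_eq_one_right h3
  filter_upwards [isOpen_ball.mem_nhds hs₀b, hconst, hl'] with s hs h1 h2
  rw [hY₂v s hs h1 h2, hY₂v s₀ hs₀b rfl hl'.self_of_nhds]
  have h3 := hY₂a s hs
  have h4 : s₁ - s₀ ≠ 0 := by rw [hs₁]; simp [hε.ne']
  field_simp
  linarith

/-! ### Linear algebra in the plane and in space. -/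

/-- The determinant of a pair of plane vectors. -/
def wedge (a b : Plane) : ℝ := a 0 * b 1 - a 1 * b 0

/-- Cramer's rule without division; it reduces values of the Hessian in an arbitrary direction to
those in two given ones. -/
theorem wedge_smul (a b v : Plane) : wedge a b • v = wedge v b • a + wedge a v • b := by
  ext i
  fin_cases i <;> simp [wedge] <;> ring

theorem exists_smul_of_wedge_eq_zero {a b : Plane} (ha : a ≠ 0) (h : wedge a b = 0) :
    ∃ r : ℝ, b = r • a := by
  have h' : a 0 * b 1 = a 1 * b 0 := by simpa [wedge, sub_eq_zero] using h
  by_cases h0 : a 0 = 0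
  · have h1 : a 1 ≠ 0 := fun h1 => ha (by ext i; fin_cases i <;> simp [h0, h1])
    refine ⟨b 1 / a 1, ?_⟩
    have hb : b 0 = 0 := by
      have : a 1 * b 0 = 0 := by rw [← h', h0, zero_mul]
      exact (mul_eq_zero.1 this).resolve_left h1
    ext i
    fin_cases i
    · simp [h0, hb]
    · simp [h1]
  · refine ⟨b 0 / a 0, ?_⟩
    ext i
    fin_cases i
    · simp [h0]
    · simp only [Fin.mk_one, PiLp.smul_apply, smul_eq_mul]
      field_simp
      linarith

/-- In space, two vectors orthogonal to a plane are parallel. -/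
theorem apply_mul_apply_comm_of_inner_eq_zero {L : Plane →L[ℝ] Space} (hL : ∀ v, ‖L v‖ = ‖v‖)
    {a b : Space} (ha : ∀ v, inner ℝ a (L v) = 0) (hb : ∀ v, inner ℝ b (L v) = 0) (i k : Fin 3) :
    a i * b k = a k * b i := by
  by_cases h0 : a = 0
  · simp [h0]
  let K : Submodule ℝ Space := LinearMap.range (L : Plane →ₗ[ℝ] Space)
  have hinj : Function.Injective (L : Plane →ₗ[ℝ] Space) := by
    rw [injective_iff_map_eq_zero]
    intro v hv
    rw [← norm_eq_zero, ← hL v, norm_eq_zero]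
    exact hv
  have hK : Module.finrank ℝ K = 2 := by
    rw [LinearMap.finrank_range_of_inj hinj]; simp
  have hK' : Module.finrank ℝ Kᗮ = 1 := by
    have := Submodule.finrank_add_finrank_orthogonal K
    rw [hK, finrank_euclideanSpace_fin] at this
    omega
  have hmem : ∀ c : Space, (∀ v, inner ℝ c (L v) = 0) → c ∈ Kᗮ := by
    intro c hc
    rw [Submodule.mem_orthogonal']
    rintro _ ⟨v, rfl⟩
    exact hc v
  obtain ⟨r, hr⟩ := (finrank_eq_one_iff_of_nonzero' (⟨a, hmem a ha⟩ : Kᗮ)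
    (by simpa [Subtype.ext_iff] using h0)).1 hK' ⟨b, hmem b hb⟩
  have hr' : b = r • a := (congrArg Subtype.val hr).symm
  rw [hr']
  simp only [PiLp.smul_apply, smul_eq_mul]
  ring

/-! ### The second derivative of an isometric immersion. -/

section Isometric

variable {D : Set Plane} {χ : Plane → Space}

theorem contDiffAt_fderiv (hD : IsOpen D) (hχ : ContDiffOn ℝ 2 χ D) {x : Plane} (hx : x ∈ D) :
    ContDiffAt ℝ 1 (fderiv ℝ χ) x :=
  (hχ.contDiffAt (hD.mem_nhds hx)).fderiv_right (by norm_num)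

theorem hasFDerivAt_fderiv (hD : IsOpen D) (hχ : ContDiffOn ℝ 2 χ D) {x : Plane} (hx : x ∈ D) :
    HasFDerivAt (fderiv ℝ χ) (fderiv ℝ (fderiv ℝ χ) x) x :=
  ((contDiffAt_fderiv hD hχ hx).differentiableAt one_ne_zero).hasFDerivAt

theorem hasFDerivAt_fderiv_apply (hD : IsOpen D) (hχ : ContDiffOn ℝ 2 χ D) {x : Plane}
    (hx : x ∈ D) (v : Plane) :
    HasFDerivAt (fun y => fderiv ℝ χ y v) ((fderiv ℝ (fderiv ℝ χ) x).flip v) x :=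
  ((ContinuousLinearMap.apply ℝ Space v).hasFDerivAt.comp x (hasFDerivAt_fderiv hD hχ hx) :)

theorem hasFDerivAt_fderiv_apply_apply (hD : IsOpen D) (hχ : ContDiffOn ℝ 2 χ D) {x : Plane}
    (hx : x ∈ D) (v : Plane) (k : Fin 3) :
    HasFDerivAt (fun y => fderiv ℝ χ y v k)
      ((EuclideanSpace.proj k : Space →L[ℝ] ℝ).comp ((fderiv ℝ (fderiv ℝ χ) x).flip v)) x :=
  ((EuclideanSpace.proj k : Space →L[ℝ] ℝ).hasFDerivAt.comp x
    (hasFDerivAt_fderiv_apply hD hχ hx v) :)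

theorem contDiffAt_fderiv_apply_apply (hD : IsOpen D) (hχ : ContDiffOn ℝ 2 χ D) {x : Plane}
    (hx : x ∈ D) (v : Plane) (k : Fin 3) : ContDiffAt ℝ 1 (fun y => fderiv ℝ χ y v k) x :=
  (EuclideanSpace.proj k : Space →L[ℝ] ℝ).contDiff.contDiffAt.comp x
    ((contDiffAt_fderiv hD hχ hx).clm_apply contDiffAt_const)

theorem fderiv_fderiv_symm (hD : IsOpen D) (hχ : ContDiffOn ℝ 2 χ D) {x : Plane} (hx : x ∈ D)
    (v w : Plane) : fderiv ℝ (fderiv ℝ χ) x v w = fderiv ℝ (fderiv ℝ χ) x w v :=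
  (hχ.contDiffAt (hD.mem_nhds hx)).isSymmSndFDerivAt (by simp) v w

/-- Differentiating the preserved inner products makes this trilinear form antisymmetric in `v, w`;
symmetry of the second derivative makes it symmetric in `u, v`. The two symmetries together force it
to vanish. -/
theorem inner_fderiv_fderiv_fderiv (hD : IsOpen D) (hχ : ContDiffOn ℝ 2 χ D)
    (hi : ∀ x ∈ D, ∀ v, ‖fderiv ℝ χ x v‖ = ‖v‖) {x : Plane} (hx : x ∈ D) (u v w : Plane) :
    inner ℝ (fderiv ℝ (fderiv ℝ χ) x u v) (fderiv ℝ χ x w) = 0 := by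
  have hconst : ∀ v w, ∀ y ∈ D, inner ℝ (fderiv ℝ χ y v) (fderiv ℝ χ y w) = inner ℝ v w :=
    fun v w y hy => (LinearMap.norm_map_iff_inner_map_map (fderiv ℝ χ y)).1 (hi y hy) v w
  have key : ∀ u v w, inner ℝ (fderiv ℝ (fderiv ℝ χ) x u v) (fderiv ℝ χ x w) =
      - inner ℝ (fderiv ℝ (fderiv ℝ χ) x u w) (fderiv ℝ χ x v) := by
    intro u v w
    have h1 := (hasFDerivAt_fderiv_apply hD hχ hx v).inner ℝ (hasFDerivAt_fderiv_apply hD hχ hx w)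
    have h2 := h1.unique ((hasFDerivAt_const (inner ℝ v w) x).congr_of_eventuallyEq
      (by filter_upwards [hD.mem_nhds hx] with y hy using hconst v w y hy))
    have h3 := DFunLike.congr_fun h2 u
    simp only [ContinuousLinearMap.comp_apply, ContinuousLinearMap.prod_apply,
      fderivInnerCLM_apply, ContinuousLinearMap.flip_apply, zero_apply] at h3
    rw [real_inner_comm] at h3
    linarith
  have hs := fderiv_fderiv_symm hD hχ hx
  have h1 := key u v w
  have h2 := key w u v
  have h3 := key v w u
  rw [hs u w] at h1
  rw [hs w v] at h2
  rw [hs v u] at h3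
  linarith

/-- The Hessian of an isometric immersion of class `C²` is degenerate: the surface has zero Gauss
curvature. -/
theorem exists_fderiv_fderiv_eq_zero (hD : IsOpen D) (hχ : ContDiffOn ℝ 2 χ D)
    (hi : ∀ x ∈ D, ∀ v, ‖fderiv ℝ χ x v‖ = ‖v‖) {x : Plane} (hx : x ∈ D) :
    ∃ v ≠ 0, ∀ w, fderiv ℝ (fderiv ℝ χ) x v w = 0 := by
  by_contra! hnd
  have hpar : ∀ y ∈ D, ∀ v w v' w' i k,
      fderiv ℝ (fderiv ℝ χ) y v w i * fderiv ℝ (fderiv ℝ χ) y v' w' k =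
        fderiv ℝ (fderiv ℝ χ) y v w k * fderiv ℝ (fderiv ℝ χ) y v' w' i :=
    fun y hy v w v' w' i k => apply_mul_apply_comm_of_inner_eq_zero (hi y hy)
      (inner_fderiv_fderiv_fderiv hD hχ hi hy v w)
      (inner_fderiv_fderiv_fderiv hD hχ hi hy v' w') i k
  obtain ⟨w₀, hw₀⟩ := hnd (EuclideanSpace.single 0 1) (by simp)
  set v₀ : Plane := EuclideanSpace.single 0 1
  obtain ⟨k, hk⟩ : ∃ k, fderiv ℝ (fderiv ℝ χ) x v₀ w₀ k ≠ 0 := by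
    by_contra! h
    exact hw₀ (by ext k; simpa using h k)
  set N := fderiv ℝ (fderiv ℝ χ) x v₀ w₀ with hN
  have hcont : ContinuousAt (fun y => fderiv ℝ (fderiv ℝ χ) y v₀ w₀ k) x := by
    have h0 : ContDiffAt ℝ 0 (fderiv ℝ (fderiv ℝ χ)) x :=
      (contDiffAt_fderiv hD hχ hx).fderiv_right (by norm_num)
    have h1 : ContDiffAt ℝ 0 (fun y => fderiv ℝ (fderiv ℝ χ) y v₀ w₀) x :=
      (h0.clm_apply contDiffAt_const).clm_apply contDiffAt_const
    exact ((EuclideanSpace.proj k : Space →L[ℝ] ℝ).contDiff.contDiffAt.comp x h1).continuousAt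
  have hne : ∀ᶠ y in 𝓝 x, y ∈ D ∧ fderiv ℝ (fderiv ℝ χ) y v₀ w₀ k ≠ 0 :=
    (hD.eventually_mem hx).and (hcont.eventually_ne hk)
  -- At each point all values of the Hessian lie on one normal line, so the differentials of the
  -- `j`-th components of the gradient are this ratio times those of the `k`-th components.
  -- Nondegeneracy turns the `k`-th components of the two partial derivatives into local
  -- coordinates, and the ratio is then locally constant.
  have hr : ∀ j, ∀ᶠ y in 𝓝 x,
      fderiv ℝ (fderiv ℝ χ) y v₀ w₀ j / fderiv ℝ (fderiv ℝ χ) y v₀ w₀ k = N j / N k := by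
    intro j
    have hd : ∀ (v : Plane) (i : Fin 3), ∀ᶠ y in 𝓝 x, HasFDerivAt (fun y => fderiv ℝ χ y v i)
        ((EuclideanSpace.proj i : Space →L[ℝ] ℝ).comp ((fderiv ℝ (fderiv ℝ χ) y).flip v)) y :=
      fun v i => by
        filter_upwards [hne] with y hy using hasFDerivAt_fderiv_apply_apply hD hχ hy.1 v i
    have hd' : ∀ v : Plane, ∀ᶠ y in 𝓝 x, HasFDerivAt (fun y => fderiv ℝ χ y v j)
        ((fderiv ℝ (fderiv ℝ χ) y v₀ w₀ j / fderiv ℝ (fderiv ℝ χ) y v₀ w₀ k) •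
          (EuclideanSpace.proj k : Space →L[ℝ] ℝ).comp ((fderiv ℝ (fderiv ℝ χ) y).flip v)) y := by
      intro v
      filter_upwards [hne, hd v j] with y hy hy'
      refine hy'.congr_fderiv ?_
      ext u
      simp only [ContinuousLinearMap.comp_apply, ContinuousLinearMap.flip_apply,
        smul_apply, PiLp.proj_apply, smul_eq_mul]
      have := hy.2
      field_simp
      linarith [hpar y hy.1 u v v₀ w₀ j k]
    refine eventually_eq_of_hasFDerivAt_smul (by simp)
      (contDiffAt_fderiv_apply_apply hD hχ hx (EuclideanSpace.single 0 1) k)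
      (contDiffAt_fderiv_apply_apply hD hχ hx (EuclideanSpace.single 1 1) k)
      (hd _ k) (hd _ k) ?_ (hd' _) (hd' _)
    intro v h0 h1
    simp only [ContinuousLinearMap.comp_apply, ContinuousLinearMap.flip_apply,
      PiLp.proj_apply] at h0 h1
    by_contra hv
    obtain ⟨w, hw⟩ := hnd v hv
    apply hw
    have hwk : fderiv ℝ (fderiv ℝ χ) x v w k = 0 := by
      have : w = w 0 • EuclideanSpace.single 0 (1 : ℝ) + w 1 • EuclideanSpace.single 1 (1 : ℝ) := by
        ext i; fin_cases i <;> simp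
      rw [this, map_add, map_smul, map_smul, PiLp.add_apply, PiLp.smul_apply, PiLp.smul_apply,
        h0, h1]
      simp
    ext i
    have := hpar x hx v w v₀ w₀ i k
    rw [hwk, zero_mul] at this
    simpa using (mul_eq_zero.1 this).resolve_right hk
  -- The fixed vector `N` is therefore normal to the surface at all nearby points. Differentiating
  -- this orthogonality in the direction `v₀` yields `⟪N, N⟫ = 0`.
  have hort : ∀ᶠ y in 𝓝 x, inner ℝ N (fderiv ℝ χ y w₀) = 0 := by
    filter_upwards [hne, eventually_all.2 hr] with y hy hy'
    have : N = (N k / fderiv ℝ (fderiv ℝ χ) y v₀ w₀ k) • fderiv ℝ (fderiv ℝ χ) y v₀ w₀ := by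
      ext j
      have h1 := hy' j
      have h2 := hy.2
      simp only [PiLp.smul_apply, smul_eq_mul]
      field_simp at h1 ⊢
      linarith
    rw [this, real_inner_smul_left, inner_fderiv_fderiv_fderiv hD hχ hi hy.1, mul_zero]
  have h1 := ((hasFDerivAt_const N x).inner ℝ (hasFDerivAt_fderiv_apply hD hχ hx w₀)).unique
    ((hasFDerivAt_const (0 : ℝ) x).congr_of_eventuallyEq hort)
  have h2 := DFunLike.congr_fun h1 v₀
  simp only [ContinuousLinearMap.comp_apply, ContinuousLinearMap.prod_apply,
    fderivInnerCLM_apply, ContinuousLinearMap.flip_apply, zero_apply,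
    inner_zero_left, add_zero] at h2
  exact hw₀ (inner_self_eq_zero.1 h2)

/-- Asymptotic directions lie in the kernel of the Hessian. -/
theorem fderiv_fderiv_eq_zero_of_asymptotic (hD : IsOpen D) (hχ : ContDiffOn ℝ 2 χ D)
    (hi : ∀ x ∈ D, ∀ v, ‖fderiv ℝ χ x v‖ = ‖v‖) {x : Plane} (hx : x ∈ D) {d : Plane}
    (hd : fderiv ℝ (fderiv ℝ χ) x d d = 0) (v : Plane) : fderiv ℝ (fderiv ℝ χ) x d v = 0 := by
  obtain ⟨v₀, hv₀, h⟩ := exists_fderiv_fderiv_eq_zero hD hχ hi hx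
  by_cases hw : wedge v₀ d = 0
  · obtain ⟨r, rfl⟩ := exists_smul_of_wedge_eq_zero hv₀ hw
    simp [h]
  · have h1 : wedge v₀ d • fderiv ℝ (fderiv ℝ χ) x d v = 0 := by
      rw [← map_smul, wedge_smul, map_add, map_smul, map_smul, hd,
        fderiv_fderiv_symm hD hχ hx d v₀, h, smul_zero, smul_zero, add_zero]
    exact (smul_eq_zero.1 h1).resolve_left hw

theorem eq_zero_of_apply_eq_zero {T : Plane →L[ℝ] Plane →L[ℝ] Space} {a b : Plane}
    (hab : wedge a b ≠ 0) (ha : ∀ v, T a v = 0) (hb : ∀ v, T b v = 0) : T = 0 := by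
  ext1 u
  ext1 v
  have h1 : wedge a b • T u v = 0 := by
    rw [← smul_apply, ← map_smul, wedge_smul, map_add, map_smul, map_smul,
      add_apply, smul_apply, smul_apply, ha, hb, smul_zero, smul_zero, add_zero]
  simpa using (smul_eq_zero.1 h1).resolve_left hab

end Isometric

/-- A function on an open interval that is affine near each point is affine. -/
theorem exists_affine_of_locally_affine {f : ℝ → ℝ} {a b : ℝ}
    (h : ∀ s ∈ Ioo a b, ∃ m : ℝ, ∀ᶠ t in 𝓝 s, f t = f s + m * (t - s)) :
    ∃ α β : ℝ, ∀ s ∈ Ioo a b, f s = α + β * s := by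
  have h1 : ∀ s ∈ Ioo a b, ∃ m : ℝ, f =ᶠ[𝓝 s] (fun t => f s + m * (t - s)) ∧
      deriv f =ᶠ[𝓝 s] fun _ => m := by
    intro s hs
    obtain ⟨m, hm⟩ := h s hs
    refine ⟨m, hm, ?_⟩
    filter_upwards [hm.eventually_nhds] with t ht
    rw [EventuallyEq.deriv_eq (f := fun u => f s + m * (u - s)) ht]
    simp
  have hdiff : ∀ s ∈ Ioo a b, DifferentiableAt ℝ f s := by
    intro s hs
    obtain ⟨m, hm, -⟩ := h1 s hs
    exact DifferentiableAt.congr_of_eventuallyEq (by fun_prop) hm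
  rcases (Ioo a b).eq_empty_or_nonempty with he | ⟨c, hc⟩
  · exact ⟨0, 0, by simp [he]⟩
  have hconst : ∀ s ∈ Ioo a b, deriv f s = deriv f c := by
    intro s hs
    refine isOpen_Ioo.is_const_of_deriv_eq_zero isPreconnected_Ioo (f := deriv f) ?_ ?_ hs hc
    · intro t ht
      obtain ⟨m, -, hm⟩ := h1 t ht
      exact ((differentiableAt_const m).congr_of_eventuallyEq hm).differentiableWithinAt
    · intro t ht
      obtain ⟨m, -, hm⟩ := h1 t ht
      rw [hm.deriv_eq]; simp
  refine ⟨f c - deriv f c * c, deriv f c, fun s hs => ?_⟩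
  have hd : ∀ t ∈ Ioo a b, HasDerivAt (fun t => f t - deriv f c * t) 0 t := fun t ht => by
    have := (hdiff t ht).hasDerivAt.sub ((hasDerivAt_id t).const_mul (deriv f c))
    refine this.congr_deriv ?_
    rw [hconst t ht]; ring
  have := isOpen_Ioo.is_const_of_deriv_eq_zero isPreconnected_Ioo
    (fun t ht => (hd t ht).differentiableAt.differentiableWithinAt)
    (fun t ht => (hd t ht).deriv) hs hc
  linarith

/-! ### Rulings up to their endpoints, and collinearity. -/

section Rulings

variable {D : Set Plane} {χ : Plane → Space} {x p : Plane}

theorem add_smul_sub_mem_openSegment (x p : Plane) {s : ℝ} (hs : s ∈ Ioo (0 : ℝ) 1) :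
    x + s • (p - x) ∈ openSegment ℝ x p := by
  rw [openSegment_eq_image']
  exact ⟨s, hs, rfl⟩

theorem IsRuling.fderiv_fderiv_eq_zero (h : IsRuling D χ x p) (hD : IsOpen D)
    (hχ : ContDiffOn ℝ 2 χ D) (hi : ∀ x ∈ D, ∀ v, ‖fderiv ℝ χ x v‖ = ‖v‖) {y : Plane}
    (hy : y ∈ openSegment ℝ x p) (v : Plane) : fderiv ℝ (fderiv ℝ χ) y (p - x) v = 0 := by
  refine fderiv_fderiv_eq_zero_of_asymptotic hD hχ hi (h.openSegment_subset hy) ?_ v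
  have := h.asymptotic y hy
  rwa [iteratedFDeriv_two_apply] at this

theorem IsRuling.fderiv_fderiv_ne_zero (h : IsRuling D χ x p) {y : Plane}
    (hy : y ∈ openSegment ℝ x p) : fderiv ℝ (fderiv ℝ χ) y ≠ 0 := by
  intro h0
  refine h.curved y hy ?_
  ext1 m
  rw [iteratedFDeriv_two_apply, h0]
  rfl

/-- Rulings in different directions do not cross inside the region. -/
theorem IsRuling.wedge_eq_zero_of_mem {x' p' y : Plane} (h : IsRuling D χ x p)
    (h' : IsRuling D χ x' p') (hD : IsOpen D) (hχ : ContDiffOn ℝ 2 χ D)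
    (hi : ∀ x ∈ D, ∀ v, ‖fderiv ℝ χ x v‖ = ‖v‖)
    (hy : y ∈ openSegment ℝ x p) (hy' : y ∈ openSegment ℝ x' p') :
    wedge (p - x) (p' - x') = 0 := by
  by_contra hw
  exact h.fderiv_fderiv_ne_zero hy (eq_zero_of_apply_eq_zero hw
    (h.fderiv_fderiv_eq_zero hD hχ hi hy) (h'.fderiv_fderiv_eq_zero hD hχ hi hy'))

theorem IsRuling.tendsto_lineMap (h : IsRuling D χ x p) :
    Tendsto (fun s : ℝ => x + s • (p - x)) (𝓝[>] 0) (𝓝[D] x) := by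
  refine tendsto_nhdsWithin_iff.2 ⟨?_, ?_⟩
  · exact (Continuous.tendsto' (by fun_prop) _ _ (by simp)).mono_left nhdsWithin_le_nhds
  · filter_upwards [Ioo_mem_nhdsGT (zero_lt_one (α := ℝ))] with s hs
    exact h.openSegment_subset (add_smul_sub_mem_openSegment _ _ hs)

/-- The curvature of the surface does not tend to zero at the endpoints of a ruling. -/
theorem IsRuling.limit_ne_zero (h : IsRuling D χ x p) (hD : IsOpen D)
    (hχ : ContDiffOn ℝ 2 χ D) (hi : ∀ x ∈ D, ∀ v, ‖fderiv ℝ χ x v‖ = ‖v‖) {e : Plane}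
    (he : wedge (p - x) e ≠ 0) {l : Space}
    (hl : Tendsto (fun y => fderiv ℝ (fderiv ℝ χ) y e e) (𝓝[D] x) (𝓝 l)) : l ≠ 0 := by
  set d := p - x with hd
  set A : ℝ × ℝ → Plane := fun z => x + z.1 • d + z.2 • e with hA
  have hAd : ∀ z, HasFDerivAt A ((ContinuousLinearMap.fst ℝ ℝ ℝ).smulRight d +
      (ContinuousLinearMap.snd ℝ ℝ ℝ).smulRight e) z := fun z =>
    ((hasFDerivAt_fst.smul_const d).const_add x).add (hasFDerivAt_snd.smul_const e)
  have hAs : ∀ s : ℝ, A (s, 0) = x + s • d := fun s => by simp [hA]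
  have hAmem : ∀ s ∈ Ioo (0 : ℝ) 1, A (s, 0) ∈ openSegment ℝ x p := fun s hs => by
    rw [hAs]; exact add_smul_sub_mem_openSegment _ _ hs
  have hAD : ∀ s ∈ Ioo (0 : ℝ) 1, A (s, 0) ∈ D := fun s hs => h.openSegment_subset (hAmem s hs)
  have hker : ∀ s ∈ Ioo (0 : ℝ) 1, ∀ v, fderiv ℝ (fderiv ℝ χ) (A (s, 0)) d v = 0 :=
    fun s hs v => h.fderiv_fderiv_eq_zero hD hχ hi (hAmem s hs) v
  have hne : ∀ s ∈ Ioo (0 : ℝ) 1, fderiv ℝ (fderiv ℝ χ) (A (s, 0)) e e ≠ 0 := by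
    intro s hs h0
    refine h.fderiv_fderiv_ne_zero (hAmem s hs) (eq_zero_of_apply_eq_zero he (hker s hs) ?_)
    intro v
    have h1 : wedge d e • fderiv ℝ (fderiv ℝ χ) (A (s, 0)) e v = 0 := by
      rw [← map_smul, wedge_smul, map_add, map_smul, map_smul, h0,
        fderiv_fderiv_symm hD hχ (hAD s hs) e d, hker s hs, smul_zero, smul_zero, add_zero]
    exact (smul_eq_zero.1 h1).resolve_left he
  have hline : ∀ s, HasDerivAt (fun s => A (s, 0)) d s := fun s => by
    have : HasDerivAt (fun s : ℝ => x + s • d) ((1 : ℝ) • d) s :=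
      ((hasDerivAt_id s).smul_const d).const_add x
    simpa [hAs] using this
  have hmid : (1 / 2 : ℝ) ∈ Ioo (0 : ℝ) 1 := by norm_num
  have hconst : ∀ s ∈ Ioo (0 : ℝ) 1, fderiv ℝ χ (A (s, 0)) = fderiv ℝ χ (A (1 / 2, 0)) := by
    intro s hs
    have hder : ∀ t ∈ Ioo (0 : ℝ) 1, HasDerivAt (fun t => fderiv ℝ χ (A (t, 0))) 0 t := by
      intro t ht
      have := (hasFDerivAt_fderiv hD hχ (hAD t ht)).comp_hasDerivAt t (hline t)
      refine this.congr_deriv ?_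
      ext1 v
      exact hker t ht v
    exact isOpen_Ioo.is_const_of_deriv_eq_zero isPreconnected_Ioo
      (fun t ht => (hder t ht).differentiableAt.differentiableWithinAt)
      (fun t ht => (hder t ht).deriv) hs hmid
  -- The gradient, hence the normal line, is constant along the ruling. A coordinate `k` that works
  -- at the midpoint therefore works on the whole ruling.
  obtain ⟨k, hk⟩ : ∃ k, fderiv ℝ (fderiv ℝ χ) (A (1 / 2, 0)) e e k ≠ 0 := by
    by_contra! hk
    exact hne _ hmid (by ext k; simpa using hk k)
  have hnek : ∀ s ∈ Ioo (0 : ℝ) 1, fderiv ℝ (fderiv ℝ χ) (A (s, 0)) e e k ≠ 0 := by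
    intro s hs h0
    refine hne s hs ?_
    ext i
    have h1 := apply_mul_apply_comm_of_inner_eq_zero (hi _ (hAD s hs))
      (inner_fderiv_fderiv_fderiv hD hχ hi (hAD s hs) e e) (b :=
        fderiv ℝ (fderiv ℝ χ) (A (1 / 2, 0)) e e) (fun v => by
          rw [hconst s hs]
          exact inner_fderiv_fderiv_fderiv hD hχ hi (hAD _ hmid) e e v) i k
    rw [h0, zero_mul] at h1
    simpa using (mul_eq_zero.1 h1).resolve_right hk
  obtain ⟨α, β, hαβ⟩ := exists_affine_of_locally_affine (a := 0) (b := 1)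
    (f := fun s => (fderiv ℝ (fderiv ℝ χ) (A (s, 0)) e e k)⁻¹) (by
      intro s hs
      have hev : ∀ᶠ z in 𝓝 (s, (0 : ℝ)), A z ∈ D :=
        (hAd (s, 0)).continuousAt.eventually (hD.eventually_mem (hAD s hs))
      have hgrad : ∀ v : Plane, ∀ᶠ z in 𝓝 (s, (0 : ℝ)),
          HasFDerivAt (fun z => fderiv ℝ χ (A z) v k)
            (fderiv ℝ (fderiv ℝ χ) (A z) d v k • ContinuousLinearMap.fst ℝ ℝ ℝ +
              fderiv ℝ (fderiv ℝ χ) (A z) e v k • ContinuousLinearMap.snd ℝ ℝ ℝ) z := by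
        intro v
        filter_upwards [hev] with z hz
        refine ((hasFDerivAt_fderiv_apply_apply hD hχ hz v k).comp z (hAd z)).congr_fderiv ?_
        ext <;> simp
      refine exists_inv_eq_affine (a := fun z => fderiv ℝ χ (A z) d k)
        (b := fun z => fderiv ℝ χ (A z) e k)
        (a₁ := fun z => fderiv ℝ (fderiv ℝ χ) (A z) d d k)
        (a₂ := fun z => fderiv ℝ (fderiv ℝ χ) (A z) d e k)
        (b₂ := fun z => fderiv ℝ (fderiv ℝ χ) (A z) e e k) ?_ ?_ (hgrad e) ?_ (hnek s hs) ?_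
      · exact (contDiffAt_fderiv_apply_apply hD hχ (hAD s hs) e k).comp (s, (0 : ℝ))
          (by fun_prop : ContDiffAt ℝ 1 A (s, 0))
      · filter_upwards [hgrad d, hev] with z hz hz'
        rwa [fderiv_fderiv_symm hD hχ hz' e d] at hz
      -- Away from the ruling the kernel vector `v` has unknown direction. By Cramer's rule it gives
      -- a nontrivial vanishing combination of the two rows of the Hessian, hence a zero
      -- determinant.
      · filter_upwards [hev] with z hz
        obtain ⟨v, hv, hv'⟩ := exists_fderiv_fderiv_eq_zero hD hχ hi hz
        have hlin : ∀ w, wedge v e * fderiv ℝ (fderiv ℝ χ) (A z) d w k +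
            wedge d v * fderiv ℝ (fderiv ℝ χ) (A z) e w k = 0 := by
          intro w
          have : wedge d e • fderiv ℝ (fderiv ℝ χ) (A z) v w = 0 := by rw [hv', smul_zero]
          rw [← smul_apply, ← map_smul, wedge_smul, map_add, map_smul, map_smul, add_apply,
            smul_apply, smul_apply] at this
          simpa using congrArg (fun u : Space => u k) this
        have h1 := hlin d
        have h2 := hlin e
        rw [fderiv_fderiv_symm hD hχ hz e d] at h1
        by_cases hve : wedge v e = 0
        · have hdv : wedge d v ≠ 0 := by
            intro hdv
            have := wedge_smul d e v
            rw [hve, hdv, zero_smul, zero_smul, add_zero] at this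
            exact hv ((smul_eq_zero.1 this).resolve_left he)
          apply mul_left_cancel₀ hdv
          linear_combination fderiv ℝ (fderiv ℝ χ) (A z) d d k * h2 -
            fderiv ℝ (fderiv ℝ χ) (A z) d e k * h1
        · apply mul_left_cancel₀ hve
          linear_combination fderiv ℝ (fderiv ℝ χ) (A z) e e k * h1 -
            fderiv ℝ (fderiv ℝ χ) (A z) d e k * h2
      · filter_upwards [isOpen_Ioo.mem_nhds hs] with t ht
        rw [hconst t ht, hconst s hs])
  rintro rfl
  have h1 : Tendsto (fun s : ℝ => fderiv ℝ (fderiv ℝ χ) (A (s, 0)) e e k) (𝓝[>] 0) (𝓝 0) := by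
    have h2 := ((EuclideanSpace.proj k : Space →L[ℝ] ℝ).continuous.tendsto 0).comp
      (hl.comp h.tendsto_lineMap)
    simp only [map_zero] at h2
    refine h2.congr fun s => ?_
    simp [hAs, hd]
  have h2 : Tendsto (fun s : ℝ => α + β * s) (𝓝[>] 0) (𝓝 α) :=
    (Continuous.tendsto' (by fun_prop) _ _ (by simp)).mono_left nhdsWithin_le_nhds
  -- A factor with limit zero times its reciprocal, which has the finite limit `α`, would tend to
  -- zero; but the product is `1`.
  have h3 : Tendsto (fun _ : ℝ => (1 : ℝ)) (𝓝[>] 0) (𝓝 (0 * α)) := by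
    refine (h1.mul h2).congr' ?_
    filter_upwards [Ioo_mem_nhdsGT (zero_lt_one (α := ℝ))] with s hs
    rw [← hαβ s hs, mul_inv_cancel₀ (hnek s hs)]
  have := tendsto_nhds_unique h3 tendsto_const_nhds
  simp at this

/-- The second derivative of a `C²` map on the closure of an open set extends continuously to the
boundary. -/
theorem exists_tendsto_fderiv_fderiv (hD : IsOpen D) (hχ : ContDiffOn ℝ 2 χ (closure D))
    (hx : x ∈ closure D) : ∃ T : Plane → Plane → Space, ∀ v w,
      Tendsto (fun y => fderiv ℝ (fderiv ℝ χ) y v w) (𝓝[D] x) (𝓝 (T v w)) := by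
  -- Smoothness on the closure supplies a Taylor series near `x` with continuous second coefficient,
  -- which inside `D` is the actual second derivative.
  obtain ⟨u, hu, q, hq⟩ := (contDiffWithinAt_nat (n := 2)).1 (hχ x hx)
  rw [insert_eq_of_mem hx] at hu
  refine ⟨fun v w => q x 2 ![v, w], fun v w => ?_⟩
  obtain ⟨O, hO, hxO, hOu⟩ := mem_nhdsWithin.1 hu
  have hsub : O ∩ D ⊆ u := fun y hy => hOu ⟨hy.1, subset_closure hy.2⟩
  have hopen : IsOpen (O ∩ D) := hO.inter hD
  have hmem : O ∩ D ∈ 𝓝[D] x := inter_comm D O ▸ inter_mem_nhdsWithin D (hO.mem_nhds hxO)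
  have hcont : Tendsto (fun y => q y 2) (𝓝[D] x) (𝓝 (q x 2)) := by
    have := hq.cont 2 le_rfl x (hOu ⟨hxO, hx⟩)
    exact this.tendsto.mono_left (nhdsWithin_le_of_mem (mem_of_superset hmem hsub))
  have happ : Continuous fun M : Plane [×2]→L[ℝ] Space => M ![v, w] := by fun_prop
  refine ((happ.tendsto _).comp hcont).congr' ?_
  filter_upwards [hmem] with y hy
  have h1 := (hq.mono hsub).eq_iteratedFDerivWithin_of_uniqueDiffOn (m := 2) le_rfl
    hopen.uniqueDiffOn hy
  rw [iteratedFDerivWithin_of_isOpen 2 hopen hy] at h1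
  simp only [Function.comp_apply]
  rw [h1, iteratedFDeriv_two_apply]
  rfl

/-- Rulings with a common endpoint are parallel. -/
theorem IsRuling.wedge_eq_zero {q : Plane} (h : IsRuling D χ x p) (h' : IsRuling D χ x q)
    (hD : IsOpen D) (hχ : IsC2IsometricImmersion D χ) : wedge (p - x) (q - x) = 0 := by
  by_contra hw
  have hχ' := hχ.contDiffOn.mono subset_closure
  obtain ⟨T, hT⟩ := exists_tendsto_fderiv_fderiv hD hχ.contDiffOn (frontier_subset_closure
    h.left_mem)
  -- The transverse vector is the direction `q - x` of the other ruling, along which the second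
  -- derivative in that direction is identically zero.
  refine h.limit_ne_zero hD hχ' hχ.isometric hw (hT _ _) ?_
  refine tendsto_nhds_unique ((hT (q - x) (q - x)).comp h'.tendsto_lineMap)
    (tendsto_const_nhds.congr' ?_)
  filter_upwards [Ioo_mem_nhdsGT (zero_lt_one (α := ℝ))] with s hs
  exact (h'.fderiv_fderiv_eq_zero hD hχ' hχ.isometric (add_smul_sub_mem_openSegment _ _ hs) _).symm

/-- Different rulings with a common endpoint leave it in opposite directions. -/
theorem RulingsMeet.exists_neg_smul {q : Plane} (h : RulingsMeet D χ x p q)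
    (hD : IsOpen D) (hχ : IsC2IsometricImmersion D χ) : ∃ r : ℝ, r < 0 ∧ q - x = r • (p - x) := by
  obtain ⟨hp, hq, hne⟩ := h
  obtain ⟨r, hr⟩ := exists_smul_of_wedge_eq_zero (sub_ne_zero.2 hp.ne.symm)
    (hp.wedge_eq_zero hq hD hχ)
  refine ⟨r, ?_, hr⟩
  have hfront : ∀ y ∈ frontier D, y ∉ D := fun y hy hy' => by
    rw [hD.frontier_eq] at hy
    exact hy.2 hy'
  -- For `r > 0` the segments overlap. Either `p = q`, or the far endpoint of the shorter one is
  -- interior to the longer one and so lies in `D`, although it is a boundary point.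
  by_contra! h0
  rcases h0.eq_or_lt with rfl | h0
  · rw [zero_smul, sub_eq_zero] at hr
    exact hq.ne hr.symm
  rcases lt_trichotomy r 1 with h1 | rfl | h1
  · refine hfront q hq.right_mem (hp.openSegment_subset ?_)
    have := add_smul_sub_mem_openSegment x p ⟨h0, h1⟩
    rwa [← hr, add_sub_cancel] at this
  · rw [one_smul] at hr
    exact hne (sub_left_injective hr).symm
  · refine hfront p hp.right_mem (hq.openSegment_subset ?_)
    have := add_smul_sub_mem_openSegment x q ⟨inv_pos.2 h0, inv_lt_one_of_one_lt₀ h1⟩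
    rwa [hr, smul_smul, inv_mul_cancel₀ h0.ne', one_smul, add_sub_cancel] at this

theorem RulingsMeet.collinear {q : Plane} (h : RulingsMeet D χ x p q)
    (hD : IsOpen D) (hχ : IsC2IsometricImmersion D χ) :
    Collinear ℝ (segment ℝ x p ∪ segment ℝ x q) := by
  obtain ⟨r, -, hr⟩ := h.exists_neg_smul hD hχ
  rw [collinear_iff_of_mem (p₀ := x) (Or.inl (left_mem_segment ℝ x p))]
  refine ⟨p - x, ?_⟩
  rintro y (hy | hy) <;> rw [segment_eq_image'] at hy <;> obtain ⟨s, -, rfl⟩ := hy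
  · exact ⟨s, by simp [add_comm]⟩
  · exact ⟨s * r, by simp [hr, mul_smul, add_comm]⟩

end Rulings

/-! ### Local shape of the boundary curve. -/

section Loop

variable {c : ℝ → Plane} {ℓ : ℝ}

theorem IsPiecewiseC2Loop.apply_eq_imp (hc : IsPiecewiseC2Loop c ℓ) {s t : ℝ} (h : c s = c t) :
    ∃ n : ℤ, t - s = n • ℓ := by
  rw [← toIcoMod_eq_toIcoMod hc.length_pos (a := 0)]
  have hmem : ∀ r, toIcoMod hc.length_pos 0 r ∈ Ico 0 ℓ := fun r => by
    simpa using toIcoMod_mem_Ico hc.length_pos 0 r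
  refine hc.injOn (hmem s) (hmem t) ?_
  rw [toIcoMod, toIcoMod, hc.periodic.sub_zsmul_eq, hc.periodic.sub_zsmul_eq, h]

/-- Near each of its points, the curve does not come back from elsewhere. -/
theorem IsPiecewiseC2Loop.exists_ball (hc : IsPiecewiseC2Loop c ℓ) (s₀ : ℝ) {δ : ℝ} (hδ : 0 < δ) :
    ∃ ρ > 0, ∀ y ∈ range c, y ∈ ball (c s₀) ρ → ∃ s ∈ Ioo (s₀ - δ) (s₀ + δ), c s = y := by
  -- The rest of one period is a compact arc that misses `c s₀`, so it stays at a positive distance.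
  set K := c '' Icc (s₀ + δ) (s₀ + ℓ - δ) with hK
  have hKc : IsClosed K := (isCompact_Icc.image hc.continuous).isClosed
  have hK0 : c s₀ ∉ K := by
    rintro ⟨s, hs, h⟩
    obtain ⟨n, hn⟩ := hc.apply_eq_imp h.symm
    rw [zsmul_eq_mul] at hn
    have h1 : 0 < (n : ℝ) * ℓ := by linarith [hs.1]
    have h2 : (n : ℝ) * ℓ < 1 * ℓ := by linarith [hs.2]
    have h3 : (0 : ℝ) < n := pos_of_mul_pos_left h1 hc.length_pos.le
    have h4 : (n : ℝ) < 1 := lt_of_mul_lt_mul_right h2 hc.length_pos.le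
    norm_cast at h3 h4
    omega
  obtain ⟨ρ, hρ, hball⟩ := Metric.isOpen_iff.1 hKc.isOpen_compl (c s₀) hK0
  refine ⟨ρ, hρ, ?_⟩
  rintro _ ⟨s, rfl⟩ hs
  set t := toIocMod hc.length_pos (s₀ - δ) s with ht
  have htm : t ∈ Ioc (s₀ - δ) (s₀ - δ + ℓ) := toIocMod_mem_Ioc hc.length_pos (s₀ - δ) s
  have hct : c t = c s := by rw [ht, toIocMod, hc.periodic.sub_zsmul_eq]
  refine ⟨t, ⟨htm.1, ?_⟩, hct⟩
  by_contra! hlt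
  exact hball hs ⟨t, ⟨hlt, by linarith [htm.2]⟩, hct⟩

theorem eventually_lt_derivWithin {S : Set ℝ} (hS : UniqueDiffOn ℝ S) (hcS : ContDiffOn ℝ 2 c S)
    {u : Plane →L[ℝ] ℝ} {z α : ℝ} (hz : z ∈ S) (h : α < u (derivWithin c S z)) :
    ∀ᶠ s in 𝓝[S] z, α < u (derivWithin c S s) := by
  have h1 : ContinuousWithinAt (derivWithin c S) S z :=
    hcS.continuousOn_derivWithin hS (by norm_num) z hz
  exact (u.continuous.continuousAt.comp_continuousWithinAt h1).eventually (lt_mem_nhds h)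

/-- Near each of its points, the curve is `C²` on either side and it moves on in some direction at
positive speed. -/
theorem IsPiecewiseC2Loop.exists_direction (hc : IsPiecewiseC2Loop c ℓ) (s₀ : ℝ) :
    ∃ e : Plane, e ≠ 0 ∧ ∃ ε > 0, ∃ δ > 0,
      StrictMonoOn (fun s => inner ℝ e (c s)) (Ioo (s₀ - δ) (s₀ + δ)) ∧
      ∀ s ∈ Ioo (s₀ - δ) (s₀ + δ), s ≠ s₀ → ContDiffAt ℝ 2 c s ∧ ε ≤ inner ℝ e (deriv c s) := by
  obtain ⟨τ, hτ, hl, hr⟩ := hc.oneSided s₀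
  set tl := derivWithin c (Iic s₀) s₀ with htl
  set tr := derivWithin c (Ici s₀) s₀ with htr
  have hnl : ‖tl‖ = 1 := hc.norm_tangent_left s₀
  have hnr : ‖tr‖ = 1 := hc.norm_tangent_right s₀
  have hpos : 0 < 1 + inner ℝ tl tr := by
    have h1 : -1 ≤ inner ℝ tl tr := by
      have := neg_le_of_abs_le (abs_real_inner_le_norm tl tr)
      rwa [hnl, hnr, one_mul] at this
    have h2 : inner ℝ tl tr ≠ -1 := fun h => hc.no_cusp s₀ (by
      rw [inner_eq_neg_one_iff_of_norm_eq_one hnl hnr] at h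
      rw [← htl, ← htr, h, neg_neg])
    have := lt_of_le_of_ne h1 h2.symm
    linarith
  -- The sum of the one-sided unit tangents has inner product `1 + ⟪tl, tr⟫` with each of them,
  -- which is positive because there is no cusp. Half of this value is kept as a lower bound `ε` for
  -- nearby speeds.
  set e := tl + tr with he
  have hel : inner ℝ e tl = 1 + inner ℝ tl tr := by
    rw [he, inner_add_left, real_inner_self_eq_norm_sq, hnl, real_inner_comm]; ring
  have her : inner ℝ e tr = 1 + inner ℝ tl tr := by
    rw [he, inner_add_left, real_inner_self_eq_norm_sq, hnr]; ring
  set ε := (1 + inner ℝ tl tr) / 2 with hε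
  have hεpos : 0 < ε := by positivity
  have hUl : UniqueDiffOn ℝ (Icc (s₀ - τ) s₀) := uniqueDiffOn_Icc (by linarith)
  have hUr : UniqueDiffOn ℝ (Icc s₀ (s₀ + τ)) := uniqueDiffOn_Icc (by linarith)
  have hsl : derivWithin c (Icc (s₀ - τ) s₀) s₀ = tl := by
    refine derivWithin_congr_set ?_
    filter_upwards [lt_mem_nhds (show s₀ - τ < s₀ by linarith)] with s hs
    exact propext ⟨fun h => h.2, fun h => ⟨le_of_lt hs, h⟩⟩
  have hsr : derivWithin c (Icc s₀ (s₀ + τ)) s₀ = tr := by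
    refine derivWithin_congr_set ?_
    filter_upwards [gt_mem_nhds (show s₀ < s₀ + τ by linarith)] with s hs
    exact propext ⟨fun h => h.1, fun h => ⟨h, le_of_lt hs⟩⟩
  have hevl := eventually_lt_derivWithin hUl hl (u := innerSL ℝ e) (α := ε)
    (right_mem_Icc.2 (by linarith)) (by rw [hsl, innerSL_apply_apply, hel]; linarith)
  have hevr := eventually_lt_derivWithin hUr hr (u := innerSL ℝ e) (α := ε)
    (left_mem_Icc.2 (by linarith)) (by rw [hsr, innerSL_apply_apply, her]; linarith)
  rw [eventually_nhdsWithin_iff, Metric.eventually_nhds_iff_ball] at hevl hevr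
  obtain ⟨δl, hδl, hbl⟩ := hevl
  obtain ⟨δr, hδr, hbr⟩ := hevr
  set δ := min τ (min δl δr) with hδ
  have hδτ : δ ≤ τ := min_le_left _ _
  have hδl' : δ ≤ δl := (min_le_right _ _).trans (min_le_left _ _)
  have hδr' : δ ≤ δr := (min_le_right _ _).trans (min_le_right _ _)
  have hδpos : 0 < δ := lt_min hτ (lt_min hδl hδr)
  have hmain : ∀ s ∈ Ioo (s₀ - δ) (s₀ + δ), s ≠ s₀ →
      ContDiffAt ℝ 2 c s ∧ ε ≤ inner ℝ e (deriv c s) := by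
    intro s hs hne
    rcases lt_or_gt_of_ne hne with hlt | hlt
    · have hn : Icc (s₀ - τ) s₀ ∈ 𝓝 s := Icc_mem_nhds (by linarith [hs.1]) hlt
      refine ⟨hl.contDiffAt hn, ?_⟩
      have := hbl s (by rw [mem_ball, Real.dist_eq, abs_lt]; constructor <;> linarith [hs.1, hs.2])
        (mem_of_mem_nhds hn)
      rw [derivWithin_of_mem_nhds hn] at this
      exact this.le
    · have hn : Icc s₀ (s₀ + τ) ∈ 𝓝 s := Icc_mem_nhds hlt (by linarith [hs.2])
      refine ⟨hr.contDiffAt hn, ?_⟩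
      have := hbr s (by rw [mem_ball, Real.dist_eq, abs_lt]; constructor <;> linarith [hs.1, hs.2])
        (mem_of_mem_nhds hn)
      rw [derivWithin_of_mem_nhds hn] at this
      exact this.le
  have hmono : ∀ S : Set ℝ, Convex ℝ S → interior S ⊆ Ioo (s₀ - δ) (s₀ + δ) \ {s₀} →
      StrictMonoOn (fun s => inner ℝ e (c s)) S := by
    intro S hS hSi
    refine strictMonoOn_of_deriv_pos hS
      (continuous_const.inner hc.continuous).continuousOn fun s hs => ?_
    obtain ⟨h1, h2⟩ := hmain s (hSi hs).1 (hSi hs).2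
    have h3 : HasDerivAt (fun s => inner ℝ e (c s)) (inner ℝ e (deriv c s)) s :=
      (innerSL ℝ e).hasFDerivAt.comp_hasDerivAt s (h1.differentiableAt two_ne_zero).hasDerivAt
    rw [h3.deriv]
    linarith
  refine ⟨e, ?_, ε, hεpos, δ, hδpos, ?_, hmain⟩
  · intro h0
    rw [h0, inner_zero_left] at hel
    linarith
  · rw [← Ioc_union_Ico_eq_Ioo (show s₀ - δ < s₀ by linarith) (show s₀ < s₀ + δ by linarith)]
    refine (hmono (Ioc (s₀ - δ) s₀) (convex_Ioc _ _) ?_).union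
      (hmono (Ico s₀ (s₀ + δ)) (convex_Ico _ _) ?_)
      ⟨right_mem_Ioc.2 (by linarith), fun s hs => hs.2⟩
      ⟨left_mem_Ico.2 (by linarith), fun s hs => hs.1⟩
    · rw [interior_Ioc]
      exact fun s hs => ⟨⟨hs.1, by linarith [hs.2]⟩, hs.2.ne⟩
    · rw [interior_Ico]
      exact fun s hs => ⟨⟨by linarith [hs.1], hs.2⟩, hs.1.ne'⟩

end Loop

/-! ### The region near a boundary point. -/

/-- In the linear coordinates `(u, η)`, whose second axis is spanned by `w`, the curve `c` is near
`c s₀` the graph of a function of `u`, and a strip around this graph contains no other point of the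
boundary of `D`. -/
structure IsGraphStrip (D : Set Plane) (c : ℝ → Plane) (u η : Plane →L[ℝ] ℝ) (w : Plane)
    (s₀ δ b ε : ℝ) : Prop where
  delta_pos : 0 < δ
  width_pos : 0 < b
  speed_pos : 0 < ε
  u_axis : u w = 0
  eta_axis : η w = 1
  eq_smul : ∀ v, u v = 0 → v = η v • w
  continuous : Continuous c
  mem_frontier : ∀ s, c s ∈ frontier D
  strictMonoOn : StrictMonoOn (fun s => u (c s)) (Ioo (s₀ - δ) (s₀ + δ))
  contDiffAt : ∀ s ∈ Ioo (s₀ - δ) (s₀ + δ), s ≠ s₀ → ContDiffAt ℝ 2 c s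
  speed_le : ∀ s ∈ Ioo (s₀ - δ) (s₀ + δ), s ≠ s₀ → ε ≤ u (deriv c s)
  notMem_frontier : ∀ s ∈ Ioo (s₀ - δ) (s₀ + δ), ∀ h, h ≠ 0 → |h| < b →
    c s + h • w ∉ frontier D

/-- Near `c s₀` every boundary point lies on the local arc, and `u` is injective on that arc; hence
a small nonzero displacement along `w` leaves the boundary. -/
theorem IsPiecewiseC2Loop.exists_isGraphStrip {c : ℝ → Plane} {ℓ : ℝ} {D : Set Plane}
    (hc : IsPiecewiseC2Loop c ℓ) (hrange : range c = frontier D) (s₀ : ℝ) :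
    ∃ u η w δ b ε, IsGraphStrip D c u η w s₀ δ b ε := by
  obtain ⟨e, he, ε, hε, δ, hδ, hmono, hmain⟩ := hc.exists_direction s₀
  obtain ⟨ρ, hρ, hball⟩ := hc.exists_ball s₀ hδ
  set w : Plane := !₂[-e 1, e 0] with hw
  have hin : ∀ v : Plane, inner ℝ e v = e 0 * v 0 + e 1 * v 1 := fun v => by
    simp [PiLp.inner_apply, Fin.sum_univ_two, mul_comm]
  have hn : 0 < e 0 * e 0 + e 1 * e 1 := by
    rw [← hin]
    exact real_inner_self_pos.2 he
  have hew : inner ℝ e w = (0 : ℝ) := by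
    rw [hin]; simp [hw]; ring
  have hinw : ∀ v : Plane, inner ℝ w v = e 0 * v 1 - e 1 * v 0 := fun v => by
    simp [hw, PiLp.inner_apply, Fin.sum_univ_two]; ring
  have hev : ∀ᶠ s in 𝓝 s₀, c s ∈ ball (c s₀) (ρ / 2) :=
    hc.continuous.continuousAt.eventually (ball_mem_nhds _ (by positivity))
  obtain ⟨δ', hδ', hb'⟩ := Metric.eventually_nhds_iff_ball.1 hev
  have hIoo : Ioo (s₀ - min δ δ') (s₀ + min δ δ') ⊆ Ioo (s₀ - δ) (s₀ + δ) :=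
    Ioo_subset_Ioo (by linarith [min_le_left δ δ']) (by linarith [min_le_left δ δ'])
  -- This width keeps displacements along `w` shorter than `ρ / 2`; the other half of `ρ` is spent
  -- on the distance from `c s` to `c s₀`.
  have hb : 0 < ρ / (2 * (‖w‖ + 1)) := by positivity
  refine ⟨innerSL ℝ e, (e 0 * e 0 + e 1 * e 1)⁻¹ • innerSL ℝ w, w, min δ δ',
    ρ / (2 * (‖w‖ + 1)), ε, lt_min hδ hδ', hb, hε, hew, ?_, ?_, hc.continuous,
    fun s => hrange ▸ mem_range_self s, hmono.mono hIoo,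
    fun s hs h => (hmain s (hIoo hs) h).1, fun s hs h => (hmain s (hIoo hs) h).2, ?_⟩
  · rw [smul_apply, innerSL_apply_apply, hinw]
    simp only [hw, smul_eq_mul, Matrix.cons_val_zero, Matrix.cons_val_one]
    rw [inv_mul_eq_one₀ hn.ne']
    ring
  · intro v hv
    rw [innerSL_apply_apply, hin] at hv
    rw [smul_apply, innerSL_apply_apply, hinw]
    have hn' : e 0 ^ 2 + e 1 ^ 2 ≠ 0 := by rw [sq, sq]; exact hn.ne'
    have hn'' : e 1 ^ 2 + e 0 ^ 2 ≠ 0 := by rwa [add_comm]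
    ext i
    fin_cases i
    · simp [hw]
      field_simp
      linear_combination (e 0) * hv
    · simp [hw]
      field_simp
      linear_combination (e 1) * hv
  · intro s hs h h0 hhb hf
    have hs' := hb' s (by
      rw [mem_ball, Real.dist_eq, abs_lt]
      constructor <;> linarith [hs.1, hs.2, min_le_right δ δ'])
    have hmem : c s + h • w ∈ ball (c s₀) ρ := by
      rw [mem_ball, dist_eq_norm] at hs' ⊢
      have h1 : ‖h • w‖ < ρ / 2 := by
        rw [norm_smul, Real.norm_eq_abs]
        calc |h| * ‖w‖ ≤ |h| * (‖w‖ + 1) := by gcongr; linarith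
          _ < ρ / (2 * (‖w‖ + 1)) * (‖w‖ + 1) := by gcongr
          _ = ρ / 2 := by field_simp
      calc ‖c s + h • w - c s₀‖ = ‖(c s - c s₀) + h • w‖ := by congr 1; abel
        _ ≤ ‖c s - c s₀‖ + ‖h • w‖ := norm_add_le _ _
        _ < ρ := by linarith
    rw [← hrange] at hf
    obtain ⟨t, ht, hct⟩ := hball _ hf hmem
    have hts : t = s := hmono.injOn ht (hIoo hs) (by
      simp only [hct, inner_add_right, inner_smul_right, hew, mul_zero, add_zero])
    rw [hts, left_eq_add, smul_eq_zero] at hct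
    rcases hct with rfl | hw0
    · exact h0 rfl
    · have h1 := congrArg (fun v : Plane => v 0) hw0
      have h2 := congrArg (fun v : Plane => v 1) hw0
      simp [hw] at h1 h2
      simp [h1, h2] at hn

theorem subset_or_disjoint_of_disjoint_frontier {D S : Set Plane} (hD : IsOpen D)
    (hS : IsPreconnected S) (h : ∀ y ∈ S, y ∉ frontier D) : S ⊆ D ∨ ∀ y ∈ S, y ∉ closure D := by
  have hcover : S ⊆ D ∪ (closure D)ᶜ := fun y hy => by
    by_cases hyc : y ∈ closure D
    · by_cases hyD : y ∈ D
      · exact Or.inl hyD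
      · exact absurd (hD.frontier_eq ▸ ⟨hyc, hyD⟩) (h y hy)
    · exact Or.inr hyc
  refine (isPreconnected_iff_subset_of_disjoint.1 hS D (closure D)ᶜ hD
    isClosed_closure.isOpen_compl hcover ?_).imp id fun h y hy => h hy
  rw [eq_empty_iff_forall_notMem]
  exact fun y hy => hy.2.2 (subset_closure hy.2.1)

namespace IsGraphStrip

variable {D : Set Plane} {c : ℝ → Plane} {u η : Plane →L[ℝ] ℝ} {w : Plane} {s₀ δ b ε : ℝ}

/-- Reversing the second axis exchanges the two sides of the graph, so that only the upper side
needs to be studied. -/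
theorem neg (h : IsGraphStrip D c u η w s₀ δ b ε) : IsGraphStrip D c u (-η) (-w) s₀ δ b ε where
  delta_pos := h.delta_pos
  width_pos := h.width_pos
  speed_pos := h.speed_pos
  u_axis := by simp [h.u_axis]
  eta_axis := by simp [h.eta_axis]
  eq_smul v hv := by simpa using h.eq_smul v hv
  continuous := h.continuous
  mem_frontier := h.mem_frontier
  strictMonoOn := h.strictMonoOn
  contDiffAt := h.contDiffAt
  speed_le := h.speed_le
  notMem_frontier s hs r hr hrb := by
    have := h.notMem_frontier s hs (-r) (neg_ne_zero.2 hr) (by rwa [abs_neg])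
    rwa [smul_neg, ← neg_smul]

theorem center_mem (h : IsGraphStrip D c u η w s₀ δ b ε) : s₀ ∈ Ioo (s₀ - δ) (s₀ + δ) :=
  ⟨by linarith [h.delta_pos], by linarith [h.delta_pos]⟩

/-- The intermediate value theorem for `u ∘ c` finds the point of the arc on the same vertical line,
and continuity of `η` bounds the height. -/
theorem eventually_mem (h : IsGraphStrip D c u η w s₀ δ b ε) {s₁ : ℝ}
    (hs₁ : s₁ ∈ Ioo (s₀ - δ) (s₀ + δ)) :
    ∀ᶠ y in 𝓝 (c s₁), ∃ s ∈ Ioo (s₀ - δ) (s₀ + δ), ∃ r, |r| < b ∧ y = c s + r • w := by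
  have hb := h.width_pos
  have hev : ∀ᶠ s in 𝓝 s₁, s ∈ Ioo (s₀ - δ) (s₀ + δ) ∧ |η (c s - c s₁)| < b / 2 := by
    refine (isOpen_Ioo.eventually_mem hs₁).and ?_
    have : Continuous fun s => |η (c s - c s₁)| :=
      (η.continuous.comp (h.continuous.sub continuous_const)).abs
    exact this.continuousAt.eventually (gt_mem_nhds (by simpa using hb))
  obtain ⟨τ, hτ, hball⟩ := Metric.nhds_basis_closedBall.eventually_iff.1 hev
  rw [Real.closedBall_eq_Icc] at hball
  have hl := (hball (left_mem_Icc.2 (by linarith))).1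
  have hr := (hball (right_mem_Icc.2 (by linarith))).1
  have hul : u (c (s₁ - τ)) < u (c s₁) := h.strictMonoOn hl hs₁ (by linarith)
  have hur : u (c s₁) < u (c (s₁ + τ)) := h.strictMonoOn hs₁ hr (by linarith)
  have hηev : ∀ᶠ y in 𝓝 (c s₁), |η (y - c s₁)| < b / 2 := by
    have : Continuous fun y => |η (y - c s₁)| :=
      (η.continuous.comp (continuous_id.sub continuous_const)).abs
    exact this.continuousAt.eventually (gt_mem_nhds (by simpa using hb))
  filter_upwards [u.continuous.continuousAt.eventually (lt_mem_nhds hul),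
    u.continuous.continuousAt.eventually (gt_mem_nhds hur), hηev] with y h1 h2 h3
  obtain ⟨s, hs, hsu⟩ := intermediate_value_Icc (show s₁ - τ ≤ s₁ + τ by linarith)
    (u.continuous.comp h.continuous).continuousOn ⟨h1.le, h2.le⟩
  simp only [Function.comp_apply] at hsu
  refine ⟨s, (hball hs).1, η (y - c s), ?_, ?_⟩
  · have : η (y - c s) = η (y - c s₁) - η (c s - c s₁) := by simp only [map_sub]; ring
    rw [this]
    have h4 := (hball hs).2
    rw [abs_lt] at h3 h4 ⊢
    constructor <;> linarith [h3.1, h3.2, h4.1, h4.2]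
  · rw [← h.eq_smul (y - c s) (by rw [map_sub, hsu, sub_self]), add_sub_cancel]

/-- Each side of the graph lies either in the region or in its exterior. -/
theorem above_subset_or (h : IsGraphStrip D c u η w s₀ δ b ε) (hD : IsOpen D) :
    (∀ s ∈ Ioo (s₀ - δ) (s₀ + δ), ∀ r ∈ Ioo 0 b, c s + r • w ∈ D) ∨
      ∀ s ∈ Ioo (s₀ - δ) (s₀ + δ), ∀ r ∈ Ioo 0 b, c s + r • w ∉ closure D := by
  have hpre : IsPreconnected
      ((fun z : ℝ × ℝ => c z.1 + z.2 • w) '' (Ioo (s₀ - δ) (s₀ + δ) ×ˢ Ioo 0 b)) := by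
    refine (isPreconnected_Ioo.prod isPreconnected_Ioo).image _ (Continuous.continuousOn ?_)
    exact (h.continuous.comp continuous_fst).add (continuous_snd.smul continuous_const)
  refine (subset_or_disjoint_of_disjoint_frontier hD hpre ?_).imp ?_ ?_
  · rintro _ ⟨⟨s, r⟩, ⟨hs, hr⟩, rfl⟩
    exact h.notMem_frontier s hs r hr.1.ne' (by rw [abs_of_pos hr.1]; exact hr.2)
  · exact fun hsub s hs r hr => hsub ⟨(s, r), ⟨hs, hr⟩, rfl⟩
  · exact fun hsub s hs r hr => hsub _ ⟨(s, r), ⟨hs, hr⟩, rfl⟩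

/-- One boundary point interior to the closure excludes the exterior along the whole strip. Applied
to both sides, this gives the closedness in the clopen argument of `notMem_interior_closure`. -/
theorem above_subset_of_mem_interior (h : IsGraphStrip D c u η w s₀ δ b ε) (hD : IsOpen D)
    {s : ℝ} (hs : s ∈ Ioo (s₀ - δ) (s₀ + δ)) (hi : c s ∈ interior (closure D)) :
    ∀ s ∈ Ioo (s₀ - δ) (s₀ + δ), ∀ r ∈ Ioo 0 b, c s + r • w ∈ D := by
  refine (h.above_subset_or hD).resolve_right fun hext => ?_
  have hcont : Tendsto (fun r : ℝ => c s + r • w) (𝓝[>] 0) (𝓝 (c s)) :=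
    (Continuous.tendsto' (by fun_prop) _ _ (by simp)).mono_left nhdsWithin_le_nhds
  obtain ⟨r, h1, h2⟩ := ((hcont.eventually (isOpen_interior.eventually_mem hi)).and
    (Ioo_mem_nhdsGT h.width_pos)).exists
  exact hext s hs r h2 (interior_subset h1)

theorem center_mem_interior (h : IsGraphStrip D c u η w s₀ δ b ε)
    (hup : ∀ s ∈ Ioo (s₀ - δ) (s₀ + δ), ∀ r ∈ Ioo 0 b, c s + r • w ∈ D)
    (hdown : ∀ s ∈ Ioo (s₀ - δ) (s₀ + δ), ∀ r ∈ Ioo 0 b, c s + r • -w ∈ D) :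
    c s₀ ∈ interior (closure D) := by
  rw [mem_interior_iff_mem_nhds]
  filter_upwards [h.eventually_mem h.center_mem]
  rintro _ ⟨s, hs, r, hr, rfl⟩
  rw [abs_lt] at hr
  rcases lt_trichotomy r 0 with h0 | rfl | h0
  · have := hdown s hs (-r) ⟨by linarith, by linarith [hr.1]⟩
    rw [neg_smul_neg] at this
    exact subset_closure this
  · rw [zero_smul, add_zero]
    exact frontier_subset_closure (h.mem_frontier s)
  · exact subset_closure (hup s hs r ⟨h0, hr.2⟩)

end IsGraphStrip

/-- A region bounded by a simple closed curve lies on one side of the curve only. -/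
theorem notMem_interior_closure {c : ℝ → Plane} {ℓ : ℝ} {D : Set Plane}
    (hc : IsPiecewiseC2Loop c ℓ) (hrange : range c = frontier D) (hD : IsOpen D)
    (hb : Bornology.IsBounded D) (s : ℝ) : c s ∉ interior (closure D) := by
  intro hs
  -- The parameters of boundary points interior to the closure form a clopen subset of the line. If
  -- there is one, all are such, and `closure D` is open, closed, nonempty and bounded in the plane.
  have hopen : IsOpen (c ⁻¹' interior (closure D)) := isOpen_interior.preimage hc.continuous
  have hclosed : IsClosed (c ⁻¹' interior (closure D)) := by
    rw [isClosed_iff_frequently]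
    intro s₀ hfreq
    obtain ⟨u, η, w, δ, b, ε, h⟩ := hc.exists_isGraphStrip hrange s₀
    obtain ⟨t, ht, ht'⟩ := (hfreq.and_eventually (isOpen_Ioo.eventually_mem h.center_mem)).exists
    exact h.center_mem_interior (h.above_subset_of_mem_interior hD ht' ht)
      (h.neg.above_subset_of_mem_interior hD ht' ht)
  have huniv : c ⁻¹' interior (closure D) = univ := IsClopen.eq_univ ⟨hclosed, hopen⟩ ⟨s, hs⟩
  have hclo : IsOpen (closure D) := by
    rw [← subset_interior_iff_isOpen]
    intro y hy
    by_cases hyD : y ∈ D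
    · exact interior_maximal subset_closure hD hyD
    · have : y ∈ frontier D := hD.frontier_eq ▸ ⟨hy, hyD⟩
      rw [← hrange] at this
      obtain ⟨t, rfl⟩ := this
      exact (huniv ▸ mem_univ t : t ∈ c ⁻¹' interior (closure D))
  have hne : (closure D).Nonempty := ⟨_, interior_subset hs⟩
  have := IsClopen.eq_univ ⟨isClosed_closure, hclo⟩ hne
  exact NormedSpace.unbounded_univ ℝ Plane (this ▸ hb.closure)

/-- In the linear coordinates `(u, η)`, the region is near `c s₀` the part of the plane above the
graph described by the curve `c`. -/
structure IsGraphChart (D : Set Plane) (c : ℝ → Plane) (u η : Plane →L[ℝ] ℝ)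
    (s₀ δ ρ ε : ℝ) : Prop where
  delta_pos : 0 < δ
  radius_pos : 0 < ρ
  speed_pos : 0 < ε
  eq_zero : ∀ v, u v = 0 → η v = 0 → v = 0
  strictMonoOn : StrictMonoOn (fun s => u (c s)) (Ioo (s₀ - δ) (s₀ + δ))
  contDiffAt : ∀ s ∈ Ioo (s₀ - δ) (s₀ + δ), s ≠ s₀ → ContDiffAt ℝ 2 c s
  speed_le : ∀ s ∈ Ioo (s₀ - δ) (s₀ + δ), s ≠ s₀ → ε ≤ u (deriv c s)
  mem_iff : ∀ s ∈ Ioo (s₀ - δ) (s₀ + δ), ∀ y ∈ ball (c s₀) ρ, u y = u (c s) →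
    (y ∈ D ↔ η (c s) < η y)

theorem IsGraphStrip.exists_isGraphChart {D : Set Plane} {c : ℝ → Plane} {u η : Plane →L[ℝ] ℝ}
    {w : Plane} {s₀ δ b ε : ℝ} (h : IsGraphStrip D c u η w s₀ δ b ε) (hD : IsOpen D)
    (hup : ∀ s ∈ Ioo (s₀ - δ) (s₀ + δ), ∀ r ∈ Ioo 0 b, c s + r • w ∈ D)
    (hdown : ∀ s ∈ Ioo (s₀ - δ) (s₀ + δ), ∀ r ∈ Ioo 0 b, c s + r • -w ∉ closure D) :
    ∃ ρ, IsGraphChart D c u η s₀ δ ρ ε := by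
  obtain ⟨ρ, hρ, hball⟩ := Metric.eventually_nhds_iff_ball.1 (h.eventually_mem h.center_mem)
  refine ⟨ρ, h.delta_pos, hρ, h.speed_pos, fun v hu hη => ?_, h.strictMonoOn, h.contDiffAt,
    h.speed_le, fun s hs y hy hus => ?_⟩
  · rw [h.eq_smul v hu, hη, zero_smul]
  · obtain ⟨t, ht, r, hr, rfl⟩ := hball y hy
    rw [map_add, map_smul, h.u_axis, smul_zero, add_zero] at hus
    obtain rfl : t = s := h.strictMonoOn.injOn ht hs hus
    rw [map_add, map_smul, h.eta_axis, smul_eq_mul, mul_one, lt_add_iff_pos_right]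
    rw [abs_lt] at hr
    refine ⟨fun hmem => ?_, fun h0 => hup t ht r ⟨h0, hr.2⟩⟩
    by_contra! h0
    rcases h0.eq_or_lt with rfl | h0
    · rw [zero_smul, add_zero] at hmem
      have := h.mem_frontier t
      rw [hD.frontier_eq] at this
      exact this.2 hmem
    · refine hdown t ht (-r) ⟨by linarith, by linarith [hr.1]⟩ ?_
      rw [neg_smul_neg]
      exact subset_closure hmem

/-- Exactly one side of the graph is inside. Two inner sides contradict `notMem_interior_closure`;
two outer sides contradict that `c s₀` is a limit of points of `D`. The sign of `η` is chosen so
that the inner side is above. -/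
theorem IsPiecewiseC2Loop.exists_isGraphChart {c : ℝ → Plane} {ℓ : ℝ} {D : Set Plane}
    (hc : IsPiecewiseC2Loop c ℓ) (hrange : range c = frontier D) (hD : IsOpen D)
    (hb : Bornology.IsBounded D) (s₀ : ℝ) : ∃ u η δ ρ ε, IsGraphChart D c u η s₀ δ ρ ε := by
  obtain ⟨u, η, w, δ, b, ε, h⟩ := hc.exists_isGraphStrip hrange s₀
  rcases h.above_subset_or hD with hup | hup <;> rcases h.neg.above_subset_or hD with hdn | hdn
  · exact absurd (h.center_mem_interior hup hdn) (notMem_interior_closure hc hrange hD hb s₀)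
  · obtain ⟨ρ, hρ⟩ := h.exists_isGraphChart hD hup hdn
    exact ⟨u, η, δ, ρ, ε, hρ⟩
  · obtain ⟨ρ, hρ⟩ := h.neg.exists_isGraphChart hD hdn (by simpa using hup)
    exact ⟨u, -η, δ, ρ, ε, hρ⟩
  · exfalso
    obtain ⟨y, hy, hyD⟩ := mem_closure_iff_nhds.1 (frontier_subset_closure (h.mem_frontier s₀)) _
      (h.eventually_mem h.center_mem)
    obtain ⟨s, hs, r, hr, rfl⟩ := hy
    rw [abs_lt] at hr
    rcases lt_trichotomy r 0 with h0 | rfl | h0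
    · refine hdn s hs (-r) ⟨by linarith, by linarith [hr.1]⟩ ?_
      rw [neg_smul_neg]
      exact subset_closure hyD
    · rw [zero_smul, add_zero] at hyD
      have := h.mem_frontier s
      rw [hD.frontier_eq] at this
      exact this.2 hyD
    · exact hup s hs r ⟨h0, hr.2⟩ (subset_closure hyD)

/-! ### One-sided germs of finite unions of intervals. -/

/-- If points of `I` accumulate at `s` from the right, order connectedness fills the gaps between
them. -/
theorem OrdConnected.eventually_nhdsGT {I : Set ℝ} (hI : I.OrdConnected) (s : ℝ) :
    (∀ᶠ t in 𝓝[>] s, t ∈ I) ∨ ∀ᶠ t in 𝓝[>] s, t ∉ I := by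
  by_cases h : ∀ᶠ t in 𝓝[>] s, t ∉ I
  · exact Or.inr h
  left
  have hf : ∃ᶠ t in 𝓝[>] s, t ∈ I := h
  obtain ⟨b, hb, hbs⟩ := (hf.and_eventually self_mem_nhdsWithin).exists
  filter_upwards [Ioo_mem_nhdsGT hbs] with t ht
  obtain ⟨a, ha, -, hat⟩ := (hf.and_eventually (Ioo_mem_nhdsGT ht.1)).exists
  exact hI.out ha hb ⟨hat.le, ht.2.le⟩

theorem OrdConnected.eventually_nhdsLT {I : Set ℝ} (hI : I.OrdConnected) (s : ℝ) :
    (∀ᶠ t in 𝓝[<] s, t ∈ I) ∨ ∀ᶠ t in 𝓝[<] s, t ∉ I := by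
  by_cases h : ∀ᶠ t in 𝓝[<] s, t ∉ I
  · exact Or.inr h
  left
  have hf : ∃ᶠ t in 𝓝[<] s, t ∈ I := h
  obtain ⟨b, hb, hbs⟩ := (hf.and_eventually self_mem_nhdsWithin).exists
  filter_upwards [Ioo_mem_nhdsLT hbs] with t ht
  obtain ⟨a, ha, hat, -⟩ := (hf.and_eventually (Ioo_mem_nhdsLT ht.2)).exists
  exact hI.out hb ha ⟨ht.1.le, hat.le⟩

/-- Applied to the zero set of the curvature, this provides on either side of each point an arc that
is straight or has no curvature zero. -/
theorem eventually_mem_sUnion_or {J : Set (Set ℝ)} (hJ : J.Finite) {l : Filter ℝ}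
    (h : ∀ I ∈ J, (∀ᶠ t in l, t ∈ I) ∨ ∀ᶠ t in l, t ∉ I) :
    (∀ᶠ t in l, t ∈ ⋃₀ J) ∨ ∀ᶠ t in l, t ∉ ⋃₀ J := by
  by_cases hex : ∃ I ∈ J, ∀ᶠ t in l, t ∈ I
  · obtain ⟨I, hI, hev⟩ := hex
    exact Or.inl (hev.mono fun t ht => ⟨I, hI, ht⟩)
  · right
    have := (hJ.eventually_all (l := l) (p := fun I t => t ∉ I)).2
      fun I hI => (h I hI).resolve_left fun hi => hex ⟨I, hI, hi⟩
    filter_upwards [this] with t ht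
    rintro ⟨I, hI, htI⟩
    exact ht I hI htI

/-! ### Slope and tangents of a plane arc. -/

section Slope

variable {c : ℝ → Plane} {u η : Plane →L[ℝ] ℝ} {α β : ℝ}

/-- The gap between the tangent at `s` and the curve grows or shrinks according to the sign of the
difference of slopes; this serves the curved and the straight case alike. -/
theorem hasDerivAt_tangent_sub (s : ℝ) {t : ℝ} (hd : HasDerivAt c (deriv c t) t)
    (hu : u (deriv c t) ≠ 0) :
    HasDerivAt (fun t => η (c s) + η (deriv c s) / u (deriv c s) * (u (c t) - u (c s)) - η (c t))
      (u (deriv c t) * (η (deriv c s) / u (deriv c s) - η (deriv c t) / u (deriv c t))) t := by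
  have h1 : HasDerivAt (fun t => u (c t)) (u (deriv c t)) t := u.hasFDerivAt.comp_hasDerivAt t hd
  have h2 : HasDerivAt (fun t => η (c t)) (η (deriv c t)) t := η.hasFDerivAt.comp_hasDerivAt t hd
  refine ((((h1.sub_const (u (c s))).const_mul _).const_add (η (c s))).sub h2).congr_deriv ?_
  field_simp

/-- A curve with decreasing slope lies below its tangents. -/
theorem lt_tangent_of_strictAntiOn (hd : ∀ s ∈ Ioo α β, HasDerivAt c (deriv c s) s)
    (hu : ∀ s ∈ Ioo α β, 0 < u (deriv c s))
    (hanti : StrictAntiOn (fun s => η (deriv c s) / u (deriv c s)) (Ioo α β)) {s t : ℝ}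
    (hs : s ∈ Ioo α β) (ht : t ∈ Ioo α β) (hne : t ≠ s) :
    η (c t) < η (c s) + η (deriv c s) / u (deriv c s) * (u (c t) - u (c s)) := by
  set g := fun t => η (c s) + η (deriv c s) / u (deriv c s) * (u (c t) - u (c s)) - η (c t)
    with hg
  have hgd : ∀ t ∈ Ioo α β, HasDerivAt g _ t := fun t ht =>
    hasDerivAt_tangent_sub s (hd t ht) (hu t ht).ne'
  have hgs : g s = 0 := by simp [hg]
  have hcont : ContinuousOn g (Ioo α β) := fun t ht => (hgd t ht).continuousAt.continuousWithinAt
  suffices 0 < g t by simpa [hg, sub_pos] using this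
  rcases lt_or_gt_of_ne hne with h | h
  · have hsub : Icc t s ⊆ Ioo α β := fun r hr => ⟨ht.1.trans_le hr.1, hr.2.trans_lt hs.2⟩
    have : StrictAntiOn g (Icc t s) := by
      refine strictAntiOn_of_deriv_neg (convex_Icc t s) (hcont.mono hsub) fun r hr => ?_
      have hr' := hsub (interior_subset hr)
      rw [interior_Icc] at hr
      rw [(hgd r hr').deriv]
      exact mul_neg_of_pos_of_neg (hu r hr') (sub_neg.2 (hanti hr' hs hr.2))
    rw [← hgs]
    exact this (left_mem_Icc.2 h.le) (right_mem_Icc.2 h.le) h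
  · have hsub : Icc s t ⊆ Ioo α β := fun r hr => ⟨hs.1.trans_le hr.1, hr.2.trans_lt ht.2⟩
    have : StrictMonoOn g (Icc s t) := by
      refine strictMonoOn_of_deriv_pos (convex_Icc s t) (hcont.mono hsub) fun r hr => ?_
      have hr' := hsub (interior_subset hr)
      rw [interior_Icc] at hr
      rw [(hgd r hr').deriv]
      exact mul_pos (hu r hr') (sub_pos.2 (hanti hs hr' hr.1))
    rw [← hgs]
    exact this (left_mem_Icc.2 h.le) (right_mem_Icc.2 h.le) h

/-- On an arc of a unit speed curve whose curvature vanishes identically or nowhere, the slope is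
constant or strictly monotone. -/
theorem slope_trichotomy (hc : ∀ s ∈ Ioo α β, ContDiffAt ℝ 2 c s)
    (hnorm : ∀ s ∈ Ioo α β, ‖deriv c s‖ = 1) (hu : ∀ s ∈ Ioo α β, 0 < u (deriv c s))
    (hinj : ∀ v, u v = 0 → η v = 0 → v = 0)
    (hcurv : (∀ s ∈ Ioo α β, iteratedDeriv 2 c s = 0) ∨
      ∀ s ∈ Ioo α β, iteratedDeriv 2 c s ≠ 0) :
    (∀ s ∈ Ioo α β, ∀ t ∈ Ioo α β, η (deriv c s) / u (deriv c s) =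
      η (deriv c t) / u (deriv c t)) ∨
    StrictMonoOn (fun s => η (deriv c s) / u (deriv c s)) (Ioo α β) ∨
    StrictAntiOn (fun s => η (deriv c s) / u (deriv c s)) (Ioo α β) := by
  have hd2 : ∀ s ∈ Ioo α β, HasDerivAt (deriv c) (iteratedDeriv 2 c s) s := by
    intro s hs
    rw [iteratedDeriv_succ, iteratedDeriv_one]
    have h1 : ContDiffAt ℝ 1 (deriv c) s := by
      have := ((hc s hs).fderiv_right (m := 1) (by norm_num)).clm_apply
        (contDiffAt_const (c := (1 : ℝ)))
      simpa using this
    exact (h1.differentiableAt one_ne_zero).hasDerivAt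
  have hM : ∀ s ∈ Ioo α β, HasDerivAt (fun s => η (deriv c s) / u (deriv c s))
      ((η (iteratedDeriv 2 c s) * u (deriv c s) - η (deriv c s) * u (iteratedDeriv 2 c s)) /
        u (deriv c s) ^ 2) s := fun s hs =>
    (η.hasFDerivAt.comp_hasDerivAt s (hd2 s hs)).div (u.hasFDerivAt.comp_hasDerivAt s (hd2 s hs))
      (hu s hs).ne'
  have hMc : ContinuousOn (fun s => η (deriv c s) / u (deriv c s)) (Ioo α β) :=
    fun s hs => (hM s hs).continuousAt.continuousWithinAt
  rcases hcurv with h0 | h0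
  · left
    intro s hs t ht
    refine isOpen_Ioo.is_const_of_deriv_eq_zero isPreconnected_Ioo
      (f := fun s => η (deriv c s) / u (deriv c s))
      (fun r hr => (hM r hr).differentiableAt.differentiableWithinAt) (fun r hr => ?_) hs ht
    rw [(hM r hr).deriv, h0 r hr]
    simp
  · right
    -- The slope is stationary only where `c''` is parallel to `c'`. Unit speed makes them
    -- orthogonal, so `c''` would vanish.
    have hne : ∀ s ∈ Ioo α β, (η (iteratedDeriv 2 c s) * u (deriv c s) -
        η (deriv c s) * u (iteratedDeriv 2 c s)) / u (deriv c s) ^ 2 ≠ 0 := by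
      intro s hs hz
      have hus := (hu s hs).ne'
      have hz' : η (iteratedDeriv 2 c s) * u (deriv c s) -
          η (deriv c s) * u (iteratedDeriv 2 c s) = 0 :=
        (div_eq_zero_iff.1 hz).resolve_right (pow_ne_zero 2 hus)
      set k := u (iteratedDeriv 2 c s) / u (deriv c s) with hk
      have hpar : iteratedDeriv 2 c s = k • deriv c s := by
        rw [← sub_eq_zero]
        apply hinj
        · rw [map_sub, map_smul, smul_eq_mul, hk]
          field_simp
          ring
        · rw [map_sub, map_smul, smul_eq_mul, hk]
          field_simp
          linarith
      have horth : inner ℝ (deriv c s) (iteratedDeriv 2 c s) = 0 := by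
        have h1 := (hd2 s hs).norm_sq
        have h2 : HasDerivAt (fun t => ‖deriv c t‖ ^ 2) 0 s := by
          refine (hasDerivAt_const s (1 : ℝ)).congr_of_eventuallyEq ?_
          filter_upwards [isOpen_Ioo.mem_nhds hs] with t ht
          rw [hnorm t ht, one_pow]
        have := h1.unique h2
        linarith
      rw [hpar, inner_smul_right, real_inner_self_eq_norm_sq, hnorm s hs, one_pow, mul_one] at horth
      exact h0 s hs (by rw [hpar, horth, zero_smul])
    -- By Darboux's theorem the nonvanishing derivative of the slope has constant sign; its
    -- continuity is not needed.
    rcases hasDerivWithinAt_forall_lt_or_forall_gt_of_forall_ne (convex_Ioo α β)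
      (fun s hs => (hM s hs).hasDerivWithinAt) hne with h | h
    · right
      refine strictAntiOn_of_deriv_neg (convex_Ioo α β) hMc fun s hs => ?_
      rw [interior_Ioo] at hs
      rw [(hM s hs).deriv]
      exact h s hs
    · left
      refine strictMonoOn_of_deriv_pos (convex_Ioo α β) hMc fun s hs => ?_
      rw [interior_Ioo] at hs
      rw [(hM s hs).deriv]
      exact h s hs

end Slope

/-! ### Meetings of rulings on smooth boundary arcs. -/

namespace IsGraphChart

variable {D : Set Plane} {c : ℝ → Plane} {u η : Plane →L[ℝ] ℝ} {s₀ δ ρ ε : ℝ}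

theorem speed_pos' (h : IsGraphChart D c u η s₀ δ ρ ε) {s : ℝ}
    (hs : s ∈ Ioo (s₀ - δ) (s₀ + δ)) (hne : s ≠ s₀) : 0 < u (deriv c s) :=
  h.speed_pos.trans_le (h.speed_le s hs hne)

theorem hasDerivAt (h : IsGraphChart D c u η s₀ δ ρ ε) {s : ℝ}
    (hs : s ∈ Ioo (s₀ - δ) (s₀ + δ)) (hne : s ≠ s₀) : HasDerivAt c (deriv c s) s :=
  ((h.contDiffAt s hs hne).differentiableAt two_ne_zero).hasDerivAt

/-- A line through a smooth boundary point that lies in the region on both sides of this point is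
tangent to the boundary, and the boundary lies below it. -/
theorem tangent_of_eventually_mem (h : IsGraphChart D c u η s₀ δ ρ ε) {s : ℝ}
    (hs : s ∈ Ioo (s₀ - δ) (s₀ + δ)) (hne : s ≠ s₀) (hball : c s ∈ ball (c s₀) ρ) {d : Plane}
    (hmem : ∀ᶠ r in 𝓝[≠] (0 : ℝ), c s + r • d ∈ D) :
    (∃ m : ℝ, m ≠ 0 ∧ d = m • deriv c s) ∧ ∀ᶠ t in 𝓝[≠] s,
      η (c t) < η (c s) + η (deriv c s) / u (deriv c s) * (u (c t) - u (c s)) := by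
  have hτ := h.speed_pos' hs hne
  have hcd := h.hasDerivAt hs hne
  have hballev : ∀ᶠ r in 𝓝 (0 : ℝ), c s + r • d ∈ ball (c s₀) ρ :=
    (Continuous.tendsto' (f := fun r : ℝ => c s + r • d) (by fun_prop) 0 (c s)
      (by simp)).eventually (isOpen_ball.eventually_mem hball)
  -- A vertical line would have points below the graph on one side, hence outside the region.
  have hud : u d ≠ 0 := by
    intro hud
    have hev : ∀ᶠ r in 𝓝[≠] (0 : ℝ), 0 < r * η d := by
      filter_upwards [hmem, hballev.filter_mono nhdsWithin_le_nhds] with r h1 h2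
      have := (h.mem_iff s hs _ h2 (by simp [hud])).1 h1
      simpa using this
    have hl := (hev.filter_mono (nhdsWithin_mono (s := Iio 0) 0 fun r hr => ne_of_lt hr)).and
      self_mem_nhdsWithin
    have hr := (hev.filter_mono (nhdsWithin_mono (s := Ioi 0) 0 fun r hr => ne_of_gt hr)).and
      self_mem_nhdsWithin
    obtain ⟨r, hr1, hr2⟩ := hr.exists
    obtain ⟨l, hl1, hl2⟩ := hl.exists
    rw [mul_pos_iff_of_pos_left hr2] at hr1
    exact absurd hl1 (not_lt.2 (mul_nonpos_of_nonpos_of_nonneg (le_of_lt hl2) hr1.le))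
  have hucd : HasDerivAt (fun t => u (c t)) (u (deriv c s)) s :=
    u.hasFDerivAt.comp_hasDerivAt s hcd
  have hr0 : Tendsto (fun t => (u (c t) - u (c s)) / u d) (𝓝 s) (𝓝 0) := by
    have : ContinuousAt (fun t => (u (c t) - u (c s)) / u d) s :=
      (hucd.continuousAt.sub continuousAt_const).div_const _
    simpa using this.tendsto
  have hIoo : ∀ᶠ t in 𝓝[≠] s, t ∈ Ioo (s₀ - δ) (s₀ + δ) :=
    (isOpen_Ioo.eventually_mem hs).filter_mono nhdsWithin_le_nhds
  have hr0' : Tendsto (fun t => (u (c t) - u (c s)) / u d) (𝓝[≠] s) (𝓝[≠] 0) := by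
    refine tendsto_nhdsWithin_iff.2 ⟨hr0.mono_left nhdsWithin_le_nhds, ?_⟩
    filter_upwards [hIoo, self_mem_nhdsWithin] with t ht hts
    exact div_ne_zero (sub_ne_zero.2 fun heq => hts (h.strictMonoOn.injOn ht hs heq)) hud
  have hlt : ∀ᶠ t in 𝓝[≠] s, η (c t) < η (c s) + (u (c t) - u (c s)) / u d * η d := by
    filter_upwards [hIoo, hr0'.eventually hmem,
      (hr0.eventually hballev).filter_mono nhdsWithin_le_nhds] with t ht h1 h2
    have hu : u (c s + ((u (c t) - u (c s)) / u d) • d) = u (c t) := by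
      rw [map_add, map_smul, smul_eq_mul]
      field_simp
      ring
    have := (h.mem_iff t ht _ h2 hu).1 h1
    rwa [map_add, map_smul, smul_eq_mul] at this
  -- The line is above the curve near `s` and touches it at `s`; Fermat's rule equates the slopes.
  have hmin : IsLocalMin (fun t => η (c s) + (u (c t) - u (c s)) / u d * η d - η (c t)) s := by
    rw [eventually_nhdsWithin_iff] at hlt
    filter_upwards [hlt] with t ht
    by_cases hts : t = s
    · rw [hts]
    · have := ht hts
      simp only [sub_self, zero_div, zero_mul, add_zero]
      linarith
  have hder : HasDerivAt (fun t => η (c s) + (u (c t) - u (c s)) / u d * η d - η (c t))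
      (u (deriv c s) / u d * η d - η (deriv c s)) s :=
    ((((hucd.sub_const (u (c s))).div_const (u d)).mul_const (η d)).const_add (η (c s))).sub
      (η.hasFDerivAt.comp_hasDerivAt s hcd)
  have hzero := hmin.hasDerivAt_eq_zero hder
  have hpar : d = (u d / u (deriv c s)) • deriv c s := by
    rw [← sub_eq_zero]
    apply h.eq_zero
    · rw [map_sub, map_smul, smul_eq_mul]
      field_simp
      ring
    · rw [map_sub, map_smul, smul_eq_mul]
      field_simp at hzero ⊢
      linarith
  refine ⟨⟨_, div_ne_zero hud hτ.ne', hpar⟩, ?_⟩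
  filter_upwards [hlt] with t ht
  have : (u (c t) - u (c s)) / u d * η d =
      η (deriv c s) / u (deriv c s) * (u (c t) - u (c s)) := by
    field_simp at hzero ⊢
    linear_combination (u (c t) - u (c s)) * hzero
  rwa [← this]

end IsGraphChart

section Meeting

variable {D : Set Plane} {χ : Plane → Space} {c : ℝ → Plane} {u η : Plane →L[ℝ] ℝ}
  {s₀ δ ρ ε : ℝ}

/-- Since `q - x = k • (p - x)` with `k < 0`, the second ruling covers the negative multiples of `p
- x`. -/
theorem RulingsMeet.eventually_mem {x p q : Plane} (h : RulingsMeet D χ x p q) (hD : IsOpen D)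
    (hχ : IsC2IsometricImmersion D χ) : ∀ᶠ r in 𝓝[≠] (0 : ℝ), x + r • (p - x) ∈ D := by
  obtain ⟨k, hk, hqp⟩ := h.exists_neg_smul hD hχ
  filter_upwards [self_mem_nhdsWithin, mem_nhdsWithin_of_mem_nhds (gt_mem_nhds zero_lt_one),
    mem_nhdsWithin_of_mem_nhds (lt_mem_nhds hk)] with r h0 h1 h2
  rcases lt_or_gt_of_ne (show r ≠ 0 from h0) with hr | hr
  · refine h.2.1.openSegment_subset ?_
    have := add_smul_sub_mem_openSegment x q (s := r / k)
      ⟨div_pos_of_neg_of_neg hr hk, by rw [div_lt_one_of_neg hk]; exact h2⟩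
    rwa [hqp, smul_smul, div_mul_cancel₀ _ hk.ne] at this
  · exact h.1.openSegment_subset (add_smul_sub_mem_openSegment x p ⟨hr, h1⟩)

/-- At a smooth boundary point where rulings meet, they are tangent to the boundary. -/
theorem RulingsMeet.exists_tangent {s : ℝ} {p q : Plane} (h : RulingsMeet D χ (c s) p q)
    (hg : IsGraphChart D c u η s₀ δ ρ ε) (hD : IsOpen D) (hχ : IsC2IsometricImmersion D χ)
    (hs : s ∈ Ioo (s₀ - δ) (s₀ + δ)) (hne : s ≠ s₀) (hball : c s ∈ ball (c s₀) ρ) :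
    (∃ (p : Plane) (m : ℝ), 0 < m ∧ IsRuling D χ (c s) p ∧ p - c s = m • deriv c s) ∧
    (∃ (p : Plane) (m : ℝ), m < 0 ∧ IsRuling D χ (c s) p ∧ p - c s = m • deriv c s) ∧ ∀ᶠ t in 𝓝[≠] s,
      η (c t) < η (c s) + η (deriv c s) / u (deriv c s) * (u (c t) - u (c s)) := by
  obtain ⟨⟨m, hm, hpm⟩, hlt⟩ := hg.tangent_of_eventually_mem hs hne hball
    (h.eventually_mem hD hχ)
  obtain ⟨k, hk, hqp⟩ := h.exists_neg_smul hD hχ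
  rw [hpm, smul_smul] at hqp
  rcases lt_or_gt_of_ne hm with h0 | h0
  · exact ⟨⟨q, k * m, mul_pos_of_neg_of_neg hk h0, h.2.1, hqp⟩, ⟨p, m, h0, h.1, hpm⟩, hlt⟩
  · exact ⟨⟨p, m, h0, h.1, hpm⟩, ⟨q, k * m, mul_neg_of_neg_of_pos hk h0, h.2.1, hqp⟩, hlt⟩

/-- A tangential ruling of a concave boundary arc contains the points of the tangent that lie over
the arc. -/
theorem IsGraphChart.mem_openSegment_of_tangent (hg : IsGraphChart D c u η s₀ δ ρ ε)
    (hD : IsOpen D) {α β : ℝ} (hsub : Ioo α β ⊆ Ioo (s₀ - δ) (s₀ + δ) \ {s₀})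
    (hnorm : ∀ s ∈ Ioo α β, ‖deriv c s‖ = 1)
    (hball : ∀ s ∈ Ioo α β, c s ∈ ball (c s₀) (ρ / 2))
    (hclose : ∀ s ∈ Ioo α β, ∀ t ∈ Ioo α β, |u (c t) - u (c s)| < ε * (ρ / 2))
    (hcont : Continuous c) {s t : ℝ} (hs : s ∈ Ioo α β) (ht : t ∈ Ioo α β)
    (hlt : ∀ t ∈ Ioo α β, t ≠ s →
      η (c t) < η (c s) + η (deriv c s) / u (deriv c s) * (u (c t) - u (c s)))
    {p : Plane} {m : ℝ} (hp : IsRuling D χ (c s) p) (hpm : p - c s = m • deriv c s)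
    (hsign : 0 < (u (c t) - u (c s)) / u (deriv c s) / m) :
    c s + ((u (c t) - u (c s)) / u (deriv c s)) • deriv c s ∈ openSegment ℝ (c s) p := by
  have hτ := hg.speed_pos' (hsub hs).1 (hsub hs).2
  set r := (u (c t) - u (c s)) / u (deriv c s) with hr
  have hm : m ≠ 0 := by rintro rfl; simp at hsign
  by_cases h1 : r / m < 1
  · have := add_smul_sub_mem_openSegment (c s) p ⟨hsign, h1⟩
    rwa [hpm, smul_smul, div_mul_cancel₀ _ hm] at this
  -- Otherwise the ruling stops at `p` no farther than over `c t`, so `p` lies over some point `c v`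
  -- of the arc. There the tangent is strictly above the boundary, which puts the boundary point `p`
  -- in `D`.
  exfalso
  push Not at h1
  have hr0 : r ≠ 0 := by intro h0; simp [h0] at hsign
  have hmr : 0 < m / r ∧ m / r ≤ 1 := by
    rw [← inv_div]
    exact ⟨inv_pos.2 hsign, inv_le_one_of_one_le₀ h1⟩
  have hcomb : u (c s) + m * u (deriv c s) = u (c s) + (m / r) * (u (c t) - u (c s)) := by
    have : u (c t) - u (c s) = r * u (deriv c s) := by rw [hr]; field_simp
    rw [this]
    field_simp
  have hmem : u (c s) + m * u (deriv c s) ∈ uIcc (u (c s)) (u (c t)) := by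
    rw [hcomb, mem_uIcc]
    rcases le_total (u (c s)) (u (c t)) with h | h
    · left
      constructor <;> nlinarith [hmr.1, hmr.2]
    · right
      constructor <;> nlinarith [hmr.1, hmr.2]
  obtain ⟨v, hv, hvu⟩ := intermediate_value_uIcc
    (f := fun t => u (c t)) (u.continuous.comp hcont).continuousOn hmem
  have hvK : v ∈ Ioo α β := ordConnected_Ioo.uIcc_subset hs ht hv
  simp only at hvu
  have hvs : v ≠ s := by
    rintro rfl
    rw [left_eq_add] at hvu
    exact (mul_ne_zero hm hτ.ne') hvu
  have hpe : p = c s + m • deriv c s := by rw [← hpm, add_sub_cancel]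
  have hmτ : m = (u (c v) - u (c s)) / u (deriv c s) := by
    rw [hvu]; field_simp; ring
  have hpD : p ∈ D := by
    refine (hg.mem_iff v (hsub hvK).1 p ?_ ?_).2 ?_
    · have h2 := hball s hs
      rw [mem_ball, dist_eq_norm] at h2 ⊢
      -- With unit speed, `|m|` is the increment of `u` divided by `u (deriv c s) ≥ ε`; this
      -- explains the bound `ε * (ρ / 2)` in `hclose`.
      have h3 : ‖m • deriv c s‖ < ρ / 2 := by
        rw [norm_smul, hnorm s hs, mul_one, hmτ, Real.norm_eq_abs, abs_div, abs_of_pos hτ,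
          div_lt_iff₀ hτ]
        calc |u (c v) - u (c s)| < ε * (ρ / 2) := hclose s hs v hvK
          _ ≤ ρ / 2 * u (deriv c s) := by
            rw [mul_comm]
            gcongr
            · linarith [hg.radius_pos]
            · exact hg.speed_le s (hsub hs).1 (hsub hs).2
      calc ‖p - c s₀‖ = ‖(c s - c s₀) + m • deriv c s‖ := by rw [hpe]; congr 1; abel
        _ ≤ ‖c s - c s₀‖ + ‖m • deriv c s‖ := norm_add_le _ _
        _ < ρ := by linarith
    · rw [hpe, map_add, map_smul, smul_eq_mul, hvu]
    · rw [hpe, map_add, map_smul, smul_eq_mul]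
      have := hlt v hvK hvs
      rw [hmτ]
      calc _ < _ := this
        _ = _ := by ring
  have := hp.right_mem
  rw [hD.frontier_eq] at this
  exact this.2 hpD

/-- On a small smooth arc whose curvature vanishes identically or nowhere, rulings meet at most
once. -/
theorem IsGraphChart.meeting_unique (hg : IsGraphChart D c u η s₀ δ ρ ε)
    (hD : IsOpen D) (hχ : IsC2IsometricImmersion D χ) {α β : ℝ}
    (hsub : Ioo α β ⊆ Ioo (s₀ - δ) (s₀ + δ) \ {s₀})
    (hnorm : ∀ s ∈ Ioo α β, ‖deriv c s‖ = 1)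
    (hball : ∀ s ∈ Ioo α β, c s ∈ ball (c s₀) (ρ / 2))
    (hclose : ∀ s ∈ Ioo α β, ∀ t ∈ Ioo α β, |u (c t) - u (c s)| < ε * (ρ / 2))
    (hcont : Continuous c)
    (hcurv : (∀ s ∈ Ioo α β, iteratedDeriv 2 c s = 0) ∨
      ∀ s ∈ Ioo α β, iteratedDeriv 2 c s ≠ 0) {s t : ℝ} (hs : s ∈ Ioo α β) (ht : t ∈ Ioo α β)
    (hst : s < t) (hms : ∃ p q, RulingsMeet D χ (c s) p q)
    (hmt : ∃ p q, RulingsMeet D χ (c t) p q) : False := by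
  have hu : ∀ s ∈ Ioo α β, 0 < u (deriv c s) := fun s hs =>
    hg.speed_pos' (hsub hs).1 (hsub hs).2
  have hd : ∀ s ∈ Ioo α β, HasDerivAt c (deriv c s) s := fun s hs =>
    hg.hasDerivAt (hsub hs).1 (hsub hs).2
  have hball' : ∀ s ∈ Ioo α β, c s ∈ ball (c s₀) ρ := fun s hs =>
    ball_subset_ball (by linarith [hg.radius_pos]) (hball s hs)
  obtain ⟨p, q, hpq⟩ := hms
  obtain ⟨p', q', hpq'⟩ := hmt
  obtain ⟨⟨P, m, hm, hP, hPm⟩, -, hev⟩ :=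
    hpq.exists_tangent hg hD hχ (hsub hs).1 (hsub hs).2 (hball' s hs)
  obtain ⟨-, ⟨P', m', hm', hP', hPm'⟩, -⟩ :=
    hpq'.exists_tangent hg hD hχ (hsub ht).1 (hsub ht).2 (hball' t ht)
  -- A single point of the arc strictly below the tangent at `s` rules out constant and increasing
  -- slope.
  obtain ⟨r, ⟨hr1, hr2⟩, hrs⟩ := ((hev.and ((isOpen_Ioo.eventually_mem hs).filter_mono
    nhdsWithin_le_nhds)).and self_mem_nhdsWithin).exists
  rcases slope_trichotomy (fun s hs => hg.contDiffAt s (hsub hs).1 (hsub hs).2) hnorm hu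
    hg.eq_zero hcurv with hconst | hmono | hanti
  · have hzero : ∀ v ∈ Ioo α β, HasDerivAt (fun t => η (c s) +
        η (deriv c s) / u (deriv c s) * (u (c t) - u (c s)) - η (c t)) 0 v := fun v hv => by
      refine (hasDerivAt_tangent_sub s (hd v hv) (hu v hv).ne').congr_deriv ?_
      rw [hconst s hs v hv, sub_self, mul_zero]
    have := isOpen_Ioo.is_const_of_deriv_eq_zero isPreconnected_Ioo
      (fun v hv => (hzero v hv).differentiableAt.differentiableWithinAt)
      (fun v hv => (hzero v hv).deriv) hr2 hs
    simp only [sub_self, mul_zero, add_zero] at this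
    linarith
  · have := lt_tangent_of_strictAntiOn (η := -η) hd hu (fun a ha b hb hab => by
      simpa [neg_div] using hmono ha hb hab) hs hr2 hrs
    simp only [neg_apply, neg_div] at this
    linarith
  have hlt := fun {s t} hs ht hne =>
    lt_tangent_of_strictAntiOn (s := s) (t := t) hd hu hanti hs ht hne
  have huc : Continuous fun v => u (c v) := u.continuous.comp hcont
  -- Each tangent is strictly above the other's point of contact, so the two tangents cross over a
  -- point `c v` with `s < v < t`. The forward ruling at `s` and the backward ruling at `t` both
  -- reach this crossing.
  have hgap : Continuous fun v => (η (c s) + η (deriv c s) / u (deriv c s) * (u (c v) - u (c s))) -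
      (η (c t) + η (deriv c t) / u (deriv c t) * (u (c v) - u (c t))) := by fun_prop
  obtain ⟨v, hv, hvz⟩ := intermediate_value_Ioo hst.le hgap.continuousOn
    (show (0 : ℝ) ∈ Ioo _ _ by
      have h1 := hlt hs ht hst.ne'
      have h2 := hlt ht hs hst.ne
      simp only [sub_self, mul_zero, add_zero, mem_Ioo]
      constructor <;> linarith)
  have hvK : v ∈ Ioo α β := ⟨hs.1.trans hv.1, hv.2.trans ht.2⟩
  have hmono' : StrictMonoOn (fun s => u (c s)) (Ioo α β) :=
    hg.strictMonoOn.mono fun s hs => (hsub hs).1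
  have husv : u (c s) < u (c v) := hmono' hs hvK hv.1
  have huvt : u (c v) < u (c t) := hmono' hvK ht hv.2
  have h1 := hg.mem_openSegment_of_tangent hD hsub hnorm hball hclose hcont hs hvK
    (fun t ht hne => hlt hs ht hne) hP hPm (div_pos (div_pos (sub_pos.2 husv) (hu s hs)) hm)
  have h2 := hg.mem_openSegment_of_tangent hD hsub hnorm hball hclose hcont ht hvK
    (fun t' ht' hne => hlt ht ht' hne) hP' hPm'
    (div_pos_of_neg_of_neg (div_neg_of_neg_of_pos (sub_neg.2 huvt) (hu t ht)) hm')
  have hus := (hu s hs).ne'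
  have hut := (hu t ht).ne'
  have heq : c s + ((u (c v) - u (c s)) / u (deriv c s)) • deriv c s =
      c t + ((u (c v) - u (c t)) / u (deriv c t)) • deriv c t := by
    rw [← sub_eq_zero]
    apply hg.eq_zero
    · simp only [map_sub, map_add, map_smul, smul_eq_mul]
      field_simp
      ring
    · simp only [map_sub, map_add, map_smul, smul_eq_mul]
      rw [← hvz]
      ring
  rw [heq] at h1
  -- Rulings through a common interior point are parallel, which contradicts the strict decrease of
  -- the slope.
  have hw := hP.wedge_eq_zero_of_mem hP' hD (hχ.contDiffOn.mono subset_closure) hχ.isometric h1 h2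
  obtain ⟨k, hk⟩ := exists_smul_of_wedge_eq_zero (sub_ne_zero.2 hP.ne.symm) hw
  rw [hPm, hPm', smul_smul] at hk
  have hku := congrArg u hk
  have hkη := congrArg η hk
  simp only [map_smul, smul_eq_mul] at hku hkη
  refine (hanti hs ht hst).ne ?_
  simp only
  rw [div_eq_div_iff hut hus]
  apply mul_left_cancel₀ hm'.ne
  linear_combination u (deriv c s) * hkη - η (deriv c s) * hku

end Meeting

/-! ### Finiteness of the meeting points. -/

theorem IsPiecewiseC2Loop.norm_deriv {c : ℝ → Plane} {ℓ : ℝ} (hc : IsPiecewiseC2Loop c ℓ) {s : ℝ}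
    (hs : ContDiffAt ℝ 2 c s) : ‖deriv c s‖ = 1 := by
  have := hc.norm_tangent_right s
  rwa [(hs.differentiableAt two_ne_zero).derivWithin (uniqueDiffWithinAt_Ici s)] at this

/-- The points of a region's boundary at which two different rulings meet are isolated. -/
theorem eventually_finite_meeting {D : Set Plane} {χ : Plane → Space} {c : ℝ → Plane} {ℓ : ℝ}
    (hc : IsPiecewiseC2Loop c ℓ) (hrange : range c = frontier D) (hD : IsOpen D)
    (hb : Bornology.IsBounded D) (hχ : IsC2IsometricImmersion D χ) (s₀ : ℝ) :
    ∃ N ∈ 𝓝[Icc 0 ℓ] s₀, {s ∈ N | ∃ p q, RulingsMeet D χ (c s) p q}.Finite := by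
  obtain ⟨u, η, δ, ρ, ε, hg⟩ := hc.exists_isGraphChart hrange hD hb s₀
  obtain ⟨J, hJ, hJI, hJe⟩ := hc.curvature_zeros
  -- Two values within `ε * (ρ / 4)` of `u (c s₀)` differ by less than the `ε * (ρ / 2)` that
  -- `meeting_unique` requires.
  have hpos : 0 < ε * (ρ / 4) := mul_pos hg.speed_pos (by linarith [hg.radius_pos])
  have huc : Continuous fun v => |u (c v) - u (c s₀)| :=
    ((u.continuous.comp hc.continuous).sub continuous_const).abs
  have hnear : ∀ᶠ s in 𝓝 s₀, s ∈ Ioo (s₀ - δ) (s₀ + δ) ∧ c s ∈ ball (c s₀) (ρ / 2) ∧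
      |u (c s) - u (c s₀)| < ε * (ρ / 4) := by
    have hδ := hg.delta_pos
    refine (isOpen_Ioo.eventually_mem ⟨by linarith, by linarith⟩).and
      ((hc.continuous.continuousAt.eventually (ball_mem_nhds _ (by linarith [hg.radius_pos]))).and
      (huc.continuousAt.eventually (gt_mem_nhds (by simpa using hpos))))
  have arc : ∀ α β, (Ioo α β ⊆ Ioo 0 ℓ) → (∀ s ∈ Ioo α β, s ≠ s₀) →
      (∀ s ∈ Ioo α β, s ∈ Ioo (s₀ - δ) (s₀ + δ) ∧ c s ∈ ball (c s₀) (ρ / 2) ∧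
        |u (c s) - u (c s₀)| < ε * (ρ / 4)) →
      ((∀ s ∈ Ioo α β, s ∈ ⋃₀ J) ∨ ∀ s ∈ Ioo α β, s ∉ ⋃₀ J) →
      {s ∈ Ioo α β | ∃ p q, RulingsMeet D χ (c s) p q}.Subsingleton := by
    intro α β h0 hne h1 h2
    have hsub : Ioo α β ⊆ Ioo (s₀ - δ) (s₀ + δ) \ {s₀} := fun s hs => ⟨(h1 s hs).1, hne s hs⟩
    have hcd : ∀ s ∈ Ioo α β, ContDiffAt ℝ 2 c s := fun s hs =>
      hg.contDiffAt s (hsub hs).1 (hsub hs).2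
    have hcurv : (∀ s ∈ Ioo α β, iteratedDeriv 2 c s = 0) ∨
        ∀ s ∈ Ioo α β, iteratedDeriv 2 c s ≠ 0 := by
      rw [← hJe] at h2
      refine h2.imp (fun h s hs => (h s hs).2.2) (fun h s hs hz => h s hs ?_)
      exact ⟨Ioo_subset_Ico_self (h0 hs), hcd s hs, hz⟩
    have huniq := fun {s t} => hg.meeting_unique (s := s) (t := t) hD hχ hsub
      (fun s hs => hc.norm_deriv (hcd s hs))
      (fun s hs => (h1 s hs).2.1) (fun s hs t ht => by
        have h3 := (h1 s hs).2.2
        have h4 := (h1 t ht).2.2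
        rw [abs_lt] at h3 h4 ⊢
        constructor <;> linarith [h3.1, h3.2, h4.1, h4.2]) hc.continuous hcurv
    rintro s ⟨hs, hms⟩ t ⟨ht, hmt⟩
    rcases lt_trichotomy s t with h | h | h
    · exact (huniq hs ht h hms hmt).elim
    · exact h
    · exact (huniq ht hs h hmt hms).elim
  -- The zeros of the curvature are described on one period only, hence the restriction to `Icc 0
  -- ℓ`. If `s₀` is not in `Ico 0 ℓ`, then `β` is chosen so that nothing of that interval is left in
  -- `Ioo s₀ β`.
  have hright : ∃ β > s₀, {s ∈ Ioo s₀ β ∩ Icc 0 ℓ |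
      ∃ p q, RulingsMeet D χ (c s) p q}.Finite := by
    by_cases hs : s₀ ∈ Ico 0 ℓ
    · have hev := ((hnear.filter_mono (nhdsWithin_le_nhds (s := Ioi s₀))).and
        (Ioo_mem_nhdsGT hs.2))
      rcases eventually_mem_sUnion_or hJ fun I hI => OrdConnected.eventually_nhdsGT (hJI I hI) s₀
        with hz | hz
      all_goals
        obtain ⟨β, hβ, hsub⟩ := (mem_nhdsGT_iff_exists_Ioo_subset).1 (hev.and hz)
        refine ⟨β, hβ, (Set.Subsingleton.finite (arc s₀ β ?_ ?_ ?_ ?_)).subset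
          fun s hs => ⟨hs.1.1, hs.2⟩⟩
        · exact fun s h => ⟨hs.1.trans_lt h.1, (hsub h).1.2.2⟩
        · exact fun s h => h.1.ne'
        · exact fun s h => (hsub h).1.1
      · exact Or.inl fun s h => (hsub h).2
      · exact Or.inr fun s h => (hsub h).2
    · by_cases h0 : s₀ < 0
      · refine ⟨0, h0, Set.Finite.subset finite_empty fun s hs' => ?_⟩
        exact absurd hs'.1.1.2 (not_lt.2 hs'.1.2.1)
      · refine ⟨s₀ + 1, by linarith, Set.Finite.subset finite_empty fun s hs' => ?_⟩
        exact hs ⟨not_lt.1 h0, hs'.1.1.1.trans_le hs'.1.2.2⟩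
  have hleft : ∃ α < s₀, {s ∈ Ioo α s₀ ∩ Icc 0 ℓ |
      ∃ p q, RulingsMeet D χ (c s) p q}.Finite := by
    by_cases hs : s₀ ∈ Ioc 0 ℓ
    · have hev := ((hnear.filter_mono (nhdsWithin_le_nhds (s := Iio s₀))).and
        (Ioo_mem_nhdsLT hs.1))
      rcases eventually_mem_sUnion_or hJ fun I hI => OrdConnected.eventually_nhdsLT (hJI I hI) s₀
        with hz | hz
      all_goals
        obtain ⟨α, hα, hsub⟩ := (mem_nhdsLT_iff_exists_Ioo_subset).1 (hev.and hz)
        refine ⟨α, hα, (Set.Subsingleton.finite (arc α s₀ ?_ ?_ ?_ ?_)).subset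
          fun s hs => ⟨hs.1.1, hs.2⟩⟩
        · exact fun s h => ⟨(hsub h).1.2.1, h.2.trans_le hs.2⟩
        · exact fun s h => h.2.ne
        · exact fun s h => (hsub h).1.1
      · exact Or.inl fun s h => (hsub h).2
      · exact Or.inr fun s h => (hsub h).2
    · by_cases h0 : ℓ < s₀
      · refine ⟨ℓ, h0, Set.Finite.subset finite_empty fun s hs' => ?_⟩
        exact absurd hs'.1.1.1 (not_lt.2 hs'.1.2.2)
      · refine ⟨s₀ - 1, by linarith, Set.Finite.subset finite_empty fun s hs' => ?_⟩
        exact hs ⟨hs'.1.2.1.trans_lt hs'.1.1.2, not_lt.1 h0⟩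
  obtain ⟨β, hβ, hfβ⟩ := hright
  obtain ⟨α, hα, hfα⟩ := hleft
  refine ⟨Ioo α β ∩ Icc 0 ℓ, inter_mem (mem_nhdsWithin_of_mem_nhds (Ioo_mem_nhds hα hβ))
    self_mem_nhdsWithin, ((hfα.union hfβ).union (finite_singleton s₀)).subset ?_⟩
  rintro s ⟨⟨hs, hsI⟩, hm⟩
  rcases lt_trichotomy s s₀ with h | h | h
  · exact Or.inl (Or.inl ⟨⟨⟨hs.1, h⟩, hsI⟩, hm⟩)
  · exact Or.inr h
  · exact Or.inl (Or.inr ⟨⟨⟨h, hs.2⟩, hsI⟩, hm⟩)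

end DevelopableRulings

theorem proposition1 (D : Set DevelopableRulings.Plane)
    (χ : DevelopableRulings.Plane → DevelopableRulings.Space)
    (hD : DevelopableRulings.IsReferenceRegion D)
    (hχ : DevelopableRulings.IsC2IsometricImmersion D χ) :
    (∀ x p q : DevelopableRulings.Plane, DevelopableRulings.RulingsMeet D χ x p q →
      Collinear ℝ (segment ℝ x p ∪ segment ℝ x q)) ∧
    {x ∈ frontier D | ∃ p q : DevelopableRulings.Plane,
      DevelopableRulings.RulingsMeet D χ x p q}.Finite := by
  refine ⟨fun x p q h => h.collinear hD.isOpen hχ, ?_⟩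
  obtain ⟨c, ℓ, hc, hrange⟩ := hD.boundary
  have hfin : {s ∈ Icc 0 ℓ | ∃ p q, DevelopableRulings.RulingsMeet D χ (c s) p q}.Finite := by
    -- Sets of parameters with finitely many meetings are stable under subsets and finite unions, so
    -- the local statement passes to the compact period.
    refine isCompact_Icc.induction_on
      (p := fun S => {s ∈ S | ∃ p q, DevelopableRulings.RulingsMeet D χ (c s) p q}.Finite)
      (by simp) (fun S T hST hT => hT.subset fun s hs => ⟨hST hs.1, hs.2⟩)
      (fun S T hS hT => (hS.union hT).subset fun s hs => hs.1.imp (⟨·, hs.2⟩) (⟨·, hs.2⟩))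
      fun s _ => DevelopableRulings.eventually_finite_meeting hc hrange hD.isOpen hD.isBounded hχ s
  refine (hfin.image c).subset ?_
  rintro x ⟨hx, hm⟩
  have himage := hc.periodic.image_Icc hc.length_pos 0
  rw [zero_add, hrange] at himage
  rw [← himage] at hx
  obtain ⟨s, hs, rfl⟩ := hx
  exact ⟨s, ⟨hs, hm⟩, rfl⟩
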